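/- Let $1\le K\le M\le N$ and $L\ge 1$ be integers, put $P=N-M+1$, and let $f_1,\dots,f_K\in[0,1)$ be distinct, $z_k=e^{2\pi i f_k}$, $Z=\operatorname{diag}(z_1,\dots,z_K)$. For $n\ge 1$ let $A_n$ be the $n\times K$ Vandermonde matrix with $(j,k)$ entry $z_k^{j-1}$, and $A=A_N$. Let $S\in\mathbb C^{K\times L}$ be fixed and let $Y=AS+E$, where the entries of the random matrix $E\in\mathbb C^{N\times L}$ are i.i.d. circularly symmetric complex Gaussian with mean zero and variance $\sigma^2$, $\sigma\ge 0$. Put $$\widehat\Sigma=\tfrac1L SS^H,\qquad \widehat\Sigma_{SS}=\frac1P\sum_{p=1}^P Z^{p-1}\widehat\Sigma Z^{1-p},\qquad \widehat\Sigma'_{SS}=\tfrac12\bigl(\widehat\Sigma_{SS}+Z^{1-M}\,\overline{\widehat\Sigma_{SS}}\,Z^{M-1}\bigr).$$ For $X\in\mathbb C^{N\times L}$ let $X_{(p)}$ ($1\le p\le P$) be the $M\times L$ matrix of rows $p,\dots,p+M-1$ of $X$, let $J$ be the $M\times M$ reversal matrix, and let $$R_{SS}(X)=\frac1{LP}\sum_{p=1}^P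 X_{(p)}X_{(p)}^H,\qquad R'_{SS}(X)=\tfrac12\bigl(R_{SS}(X)+J\,\overline{R_{SS}(X)}\,J\bigr).$$ Let $U$ and $\widehat U$ be $M\times K$ matrices whose columns are the first $K$ orthonormal eigenvectors (eigenvalues in descending order) of $R'_{SS}(AS)$ and of $R'_{SS}(Y)$, respectively. Let $\|\cdot\|$ be the spectral norm, $\sigma_j(\cdot)$ and $\lambda_j(\cdot)$ the $j$-th greatest singular value and eigenvalue, and let $\operatorname{dist}(\widehat U,U)=\|\sin\Theta\|$, where $\Theta=\operatorname{diag}(\theta_1,\dots,\theta_K)$ and $\theta_j=\arccos\sigma_j(\widehat U^HU)$. Assume that $\widehat\Sigma'_{SS}$ is positive definite and that $$B:=\frac{12\,\sigma\,\|A_M\|\,\|\widehat\Sigma\|^{1/2}\sqrt{\tfrac ML}+16\,\sigma^2\max\Bigl\{\sqrt{\tfrac ML},\tfrac ML\Bigr\}}{\sigma_K^2(A_M)\,\lambda_K(\widehat\Sigma'_{SS})}<0.586 .$$ Then the column space of $U$ is the column space of $A_M$ (the signal subspace), and with probability at least $1-3Pe^{-M/2}$ one has $\operatorname{dist}(\widehat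 U,U)\le B$ (for every admissible choice of $\widehat U$ and $U$). -/

import Mathlib

open MeasureTheory ProbabilityTheory
open scoped Matrix Matrix.Norms.L2Operator NNReal ComplexOrder

noncomputable section

namespace FBSS

/-! Throughout, indices start at `0`, and `‖A‖` is the spectral norm of a matrix `A`. -/

/-- The `j`-th greatest singular value of `A`, with `j` counted from `1`. -/
def sv {m n : ℕ} (A : Matrix (Fin m) (Fin n) ℂ) (j : ℕ) : ℝ :=
  (Matrix.toEuclideanLin A).singularValues (j - 1)

/-- The eigenvalues of a Hermitian matrix in descending order. -/
def eigDesc {n : ℕ} {A : Matrix (Fin n) (Fin n) ℂ} (hA : A.IsHermitian) (j : Fin n) : ℝ :=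
  hA.eigenvalues₀ (Fin.cast (Fintype.card_fin n).symm j)

/-- The entrywise complex conjugate of a matrix. -/
def conj {m n : ℕ} (A : Matrix (Fin m) (Fin n) ℂ) : Matrix (Fin m) (Fin n) ℂ :=
  A.map (starRingEnd ℂ)

/-! ### The array -/

/-- The node `z_k = exp(2 π i f_k)`. -/
def node {K : ℕ} (f : Fin K → ℝ) (k : Fin K) : ℂ :=
  Complex.exp (2 * Real.pi * Complex.I * f k)

/-- The `n × K` Vandermonde matrix with rows `1, z, …, z ^ (n - 1)`. -/
def vander (n : ℕ) {K : ℕ} (f : Fin K → ℝ) : Matrix (Fin n) (Fin K) ℂ :=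
  Matrix.of fun i k => node f k ^ (i : ℕ)

/-- The power `Z ^ a` of `Z = diag(z_1, …, z_K)`. -/
def Zpow {K : ℕ} (f : Fin K → ℝ) (a : ℤ) : Matrix (Fin K) (Fin K) ℂ :=
  Matrix.diagonal fun k => node f k ^ a

/-! ### Noise -/

/-- The circularly symmetric complex Gaussian distribution with mean `0` and variance `v`:
real and imaginary part are independent real Gaussians of variance `v / 2`. -/
def complexGaussian (v : ℝ≥0) : Measure ℂ :=
  ((gaussianReal 0 (v / 2)).prod (gaussianReal 0 (v / 2))).map fun x => (⟨x.1, x.2⟩ : ℂ)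

/-- The entries of the random matrix `E` are i.i.d. complex Gaussian with mean zero and
variance `σ ^ 2`. -/
structure IsGaussianNoise {Ω : Type*} [MeasurableSpace Ω] (μ : Measure Ω) {N L : ℕ}
    (E : Ω → Matrix (Fin N) (Fin L) ℂ) (σ : ℝ) : Prop where
  indep : iIndepFun (fun (q : Fin N × Fin L) ω => E ω q.1 q.2) μ
  law : ∀ n l, HasLaw (fun ω => E ω n l) (complexGaussian (Real.toNNReal (σ ^ 2))) μ

/-! ### Source covariance matrices -/

/-- The sample source covariance `(1 / L) S Sᴴ`. -/
def sourceCov {K L : ℕ} (S : Matrix (Fin K) (Fin L) ℂ) : Matrix (Fin K) (Fin K) ℂ :=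
  (1 / L : ℂ) • (S * Sᴴ)

/-- The forward-smoothed source covariance `(1 / P) ∑ p, Z ^ (p - 1) Σ Z ^ (1 - p)`
(here `p` starts at `0`). -/
def smoothedSource (P : ℕ) {K : ℕ} (f : Fin K → ℝ) (C : Matrix (Fin K) (Fin K) ℂ) :
    Matrix (Fin K) (Fin K) ℂ :=
  (1 / P : ℂ) • ∑ p : Fin P, Zpow f (p : ℤ) * C * Zpow f (-(p : ℤ))

/-- The forward-backward-smoothed source covariance
`(1 / 2) (Σ_SS + Z ^ (1 - M) conj(Σ_SS) Z ^ (M - 1))`. -/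
def smoothedSourceFB (M P : ℕ) {K : ℕ} (f : Fin K → ℝ) (C : Matrix (Fin K) (Fin K) ℂ) :
    Matrix (Fin K) (Fin K) ℂ :=
  (1 / 2 : ℂ) • (smoothedSource P f C
    + Zpow f (1 - (M : ℤ)) * conj (smoothedSource P f C) * Zpow f ((M : ℤ) - 1))

/-! ### Smoothed data covariance matrices and their leading eigenvectors -/

/-- The data of the `p`-th subarray: `M` consecutive rows of `Y`, starting from row `p`. -/
def subarray {N M P L : ℕ} (hN : M + P = N + 1) (Y : Matrix (Fin N) (Fin L) ℂ) (p : Fin P) :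
    Matrix (Fin M) (Fin L) ℂ :=
  Matrix.of fun i l => Y ⟨(p : ℕ) + (i : ℕ), by omega⟩ l

/-- The forward-smoothed sample covariance `(1 / (L P)) ∑ p, Y_(p) Y_(p)ᴴ`. -/
def dataCovSS {N M P L : ℕ} (hN : M + P = N + 1) (Y : Matrix (Fin N) (Fin L) ℂ) :
    Matrix (Fin M) (Fin M) ℂ :=
  (1 / (L * P) : ℂ) • ∑ p : Fin P, subarray hN Y p * (subarray hN Y p)ᴴ

/-- The `M × M` reversal matrix. -/
def reversal (M : ℕ) : Matrix (Fin M) (Fin M) ℂ :=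
  Matrix.of fun i j => if j = Fin.rev i then 1 else 0

/-- The forward-backward-smoothed sample covariance `(1 / 2) (R_SS + J conj(R_SS) J)`. -/
def dataCovFB {N M P L : ℕ} (hN : M + P = N + 1) (Y : Matrix (Fin N) (Fin L) ℂ) :
    Matrix (Fin M) (Fin M) ℂ :=
  (1 / 2 : ℂ) • (dataCovSS hN Y + reversal M * conj (dataCovSS hN Y) * reversal M)

/-- The columns of `U` are the first `K` eigenvectors in some eigendecomposition
`R = V diag(lam) Vᴴ`, with `V` unitary and the eigenvalues `lam` in descending order. -/
def IsLeadingEigenvectors {M K : ℕ} (hKM : K ≤ M) (R : Matrix (Fin M) (Fin M) ℂ)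
    (U : Matrix (Fin M) (Fin K) ℂ) : Prop :=
  ∃ V ∈ Matrix.unitaryGroup (Fin M) ℂ, ∃ lam : Fin M → ℝ, Antitone lam ∧
    R = V * Matrix.diagonal (fun j => (lam j : ℂ)) * Vᴴ ∧
    ∀ i j, U i j = V i (Fin.castLE hKM j)

/-! ### Distance between subspaces -/

/-- The `j`-th canonical angle `arccos σ_j(Ûᴴ U)`, with `j` counted from `0`. -/
def canonicalAngle {M K : ℕ} (Uhat U : Matrix (Fin M) (Fin K) ℂ) (j : Fin K) : ℝ :=
  Real.arccos (sv (Uhatᴴ * U) ((j : ℕ) + 1))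

/-- `dist(Û, U) = ‖sin Θ(Û, U)‖`, for `Û`, `U` with orthonormal columns. -/
def subspaceDist {M K : ℕ} (Uhat U : Matrix (Fin M) (Fin K) ℂ) : ℝ :=
  ‖(Matrix.diagonal fun j => ((Real.sin (canonicalAngle Uhat U j) : ℝ) : ℂ) :
    Matrix (Fin K) (Fin K) ℂ)‖

/-- The error bound: `lamK` stands for the smallest eigenvalue of the smoothed source
covariance. -/
def errorBound (M : ℕ) {K L : ℕ} (f : Fin K → ℝ) (S : Matrix (Fin K) (Fin L) ℂ)
    (σ lamK : ℝ) : ℝ :=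
  (12 * σ * ‖vander M f‖ * Real.sqrt ‖sourceCov S‖ * Real.sqrt ((M : ℝ) / L)
      + 16 * σ ^ 2 * max (Real.sqrt ((M : ℝ) / L)) ((M : ℝ) / L))
    / (sv (vander M f) K ^ 2 * lamK)

end FBSS

end

/-! Shifting a Vandermonde matrix by `p` rows multiplies it on the right by `Z ^ p`, and reversing
and conjugating it multiplies it by `Z ^ (1 - M)`. Hence the noiseless smoothed covariance is
exactly `A_M Σ' A_Mᴴ`. When `Σ'` is positive definite, this has rank `K`, its leading eigenvectors
span the range of `A_M`, and its nonzero eigenvalues are at least `g = σ_K(A_M)² λ_K(Σ')`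
(`leading_eigenvectors_of_factorization`).

With noise, the covariance is the noiseless one plus `σ² I` plus an error `Δ`. The multiple of the
identity moves no eigenvector. Weyl's inequality keeps the top `K` shifted eigenvalues above `g -
‖Δ‖`, while the noiseless tail eigenvalues vanish, so Davis-Kahan (`norm_tail_mul_head_le`) bounds
the sine by `‖Δ‖ / (g - ‖Δ‖)`. This is at most `2‖Δ‖ / g` once `‖Δ‖ ≤ g / 2`, and `B` is a bound for
`2‖Δ‖ / g` on a good event.

The error is an average over subarrays of signal-noise cross terms and centred Wishart matrices, and
the backward half does not increase its norm. Both kinds of term are controlled without a net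
(`measure_le_of_large_on_cap`). A Hermitian form of large norm is large, up to sign, on a whole cap
around an extremal eigenvector. A cap `|⟨v, u⟩|² ≥ 7/8` carries a fraction `8 ^ (1 - M)` of all
directions. So an exponential moment bound for each fixed direction, averaged over a random
direction, yields a tail bound at the price of `8 ^ M`. Each subarray fails with probability at most
`(1 + 2) e^{-M/2}`: one event for the cross term, one for each sign of the Wishart deviation. -/

noncomputable section

namespace FBSS

/-! ### Standard Gaussian measures on real inner product spaces. -/

section Gaussian

open scoped RealInnerProductSpace

variable {E F : Type*} [NormedAddCommGroup E] [InnerProductSpace ℝ E] [FiniteDimensional ℝ E]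
  [MeasurableSpace E] [BorelSpace E] [NormedAddCommGroup F] [InnerProductSpace ℝ F]
  [FiniteDimensional ℝ F] [MeasurableSpace F] [BorelSpace F]

/-- A map with an isometric formal adjoint sends the standard Gaussian to the standard Gaussian. -/
lemma map_stdGaussian_of_isometric_adjoint {T : E → F} {T' : F → E} (hT : Measurable T)
    (hadj : ∀ x t, ⟪T x, t⟫ = ⟪x, T' t⟫) (hnorm : ∀ t, ‖T' t‖ = ‖t‖) :
    (stdGaussian E).map T = stdGaussian F := by
  have : IsProbabilityMeasure ((stdGaussian E).map T) :=
    Measure.isProbabilityMeasure_map hT.aemeasurable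
  apply Measure.ext_of_charFun
  ext t
  rw [charFun_apply, integral_map hT.aemeasurable (by fun_prop)]
  simp_rw [hadj]
  rw [← charFun_apply, charFun_stdGaussian, charFun_stdGaussian, hnorm]

/-- The functional `⟪a, ·⟫` is `N(0, ‖a‖²)`. Read backwards, the identity linearises the exponential
of a squared norm. -/
lemma lintegral_exp_inner_stdGaussian (a : E) :
    ∫⁻ x, ENNReal.ofReal (Real.exp ⟪a, x⟫) ∂(stdGaussian E)
      = ENNReal.ofReal (Real.exp (‖a‖ ^ 2 / 2)) := by
  have hmap := IsGaussian.map_eq_gaussianReal (μ := stdGaussian E) (innerSL ℝ a)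
  rw [integral_strongDual_stdGaussian, variance_dual_stdGaussian, innerSL_apply_norm] at hmap
  have hm : Measurable (innerSL ℝ a) := (innerSL ℝ a).continuous.measurable
  have h1 : ∫⁻ x, ENNReal.ofReal (Real.exp ⟪a, x⟫) ∂(stdGaussian E)
      = ∫⁻ y, ENNReal.ofReal (Real.exp y) ∂((stdGaussian E).map (innerSL ℝ a)) := by
    rw [lintegral_map (by fun_prop) hm]; rfl
  rw [h1, hmap, ← ofReal_integral_eq_lintegral_ofReal]
  · have := congrFun (mgf_id_gaussianReal (μ := 0) (v := (‖a‖ ^ 2).toNNReal)) 1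
    simp only [mgf, id, one_mul] at this
    rw [this]
    simp
  · have := integrable_exp_mul_gaussianReal (μ := 0) (v := (‖a‖ ^ 2).toNNReal) 1
    simpa using this
  · exact Filter.Eventually.of_forall fun x => (Real.exp_pos _).le

end Gaussian

/-! ### Complex Gaussian vectors and their exponential moments. -/

section ComplexGaussian

open scoped RealInnerProductSpace

lemma integrable_exp_sq_gaussianReal {θ : ℝ} (hθ : θ < 1) :
    Integrable (fun x : ℝ => Real.exp (θ / 2 * x ^ 2)) (gaussianReal 0 1) := by
  rw [gaussianReal_of_var_ne_zero _ one_ne_zero, gaussianPDF_def,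
    integrable_withDensity_iff_integrable_smul' (by fun_prop) (by simp)]
  have h := (integrable_exp_neg_mul_sq (b := (1 - θ) / 2) (by linarith)).const_mul (√(2 * Real.pi))⁻¹
  refine h.congr (Filter.Eventually.of_forall fun x => ?_)
  simp only [smul_eq_mul]
  rw [ENNReal.toReal_ofReal (gaussianPDFReal_nonneg _ _ _), gaussianPDFReal]
  simp only [NNReal.coe_one, mul_one, sub_zero]
  rw [mul_assoc, ← Real.exp_add]
  ring_nf

lemma integral_exp_sq_gaussianReal {θ : ℝ} (hθ : θ < 1) :
    ∫ x : ℝ, Real.exp (θ / 2 * x ^ 2) ∂(gaussianReal 0 1) = (√(1 - θ))⁻¹ := by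
  rw [integral_gaussianReal_eq_integral_smul one_ne_zero]
  have h (x : ℝ) : gaussianPDFReal 0 1 x • Real.exp (θ / 2 * x ^ 2)
      = (√(2 * Real.pi))⁻¹ * Real.exp (-((1 - θ) / 2) * x ^ 2) := by
    rw [gaussianPDFReal, smul_eq_mul]
    simp only [NNReal.coe_one, mul_one, sub_zero]
    rw [mul_assoc, ← Real.exp_add]
    ring_nf
  simp_rw [h]
  rw [integral_const_mul, integral_gaussian]
  have h1 : Real.pi / ((1 - θ) / 2) = (2 * Real.pi) / (1 - θ) := by
    have : 1 - θ ≠ 0 := by linarith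
    field_simp
  rw [h1, Real.sqrt_div (by positivity)]
  have : √(2 * Real.pi) ≠ 0 := by positivity
  field_simp

instance (v : ℝ≥0) : IsProbabilityMeasure (complexGaussian v) :=
  Measure.isProbabilityMeasure_map (by
    exact (Complex.measurableEquivRealProd.symm.measurable).aemeasurable)

lemma measurable_complex_mk : Measurable fun x : ℝ × ℝ => (⟨x.1, x.2⟩ : ℂ) :=
  Complex.measurableEquivRealProd.symm.measurable

lemma integrable_exp_norm_sq_complexGaussian {θ : ℝ} (hθ : θ < 1) :
    Integrable (fun z : ℂ => Real.exp (θ / 2 * ‖z‖ ^ 2)) (complexGaussian 2) := by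
  rw [complexGaussian, integrable_map_measure (by fun_prop) measurable_complex_mk.aemeasurable,
    div_self two_ne_zero]
  refine ((integrable_exp_sq_gaussianReal hθ).mul_prod (integrable_exp_sq_gaussianReal hθ)).congr
    (Filter.Eventually.of_forall fun x => ?_)
  simp only [Function.comp, Complex.sq_norm, Complex.normSq_mk]
  rw [← Real.exp_add]
  ring_nf

lemma integral_exp_norm_sq_complexGaussian {θ : ℝ} (hθ : θ < 1) :
    ∫ z : ℂ, Real.exp (θ / 2 * ‖z‖ ^ 2) ∂(complexGaussian 2) = (1 - θ)⁻¹ := by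
  rw [complexGaussian, integral_map measurable_complex_mk.aemeasurable (by fun_prop),
    div_self two_ne_zero]
  have h (x : ℝ × ℝ) : Real.exp (θ / 2 * ‖(⟨x.1, x.2⟩ : ℂ)‖ ^ 2)
      = Real.exp (θ / 2 * x.1 ^ 2) * Real.exp (θ / 2 * x.2 ^ 2) := by
    rw [Complex.sq_norm, Complex.normSq_mk, ← Real.exp_add]
    ring_nf
  simp_rw [h]
  rw [integral_prod_mul (fun x : ℝ => Real.exp (θ / 2 * x ^ 2))
    (fun x : ℝ => Real.exp (θ / 2 * x ^ 2)), integral_exp_sq_gaussianReal hθ, ← mul_inv,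
    Real.mul_self_sqrt (by linarith)]

lemma charFun_complexGaussian_two (t : ℂ) :
    charFun (complexGaussian 2) t = Complex.exp (-‖t‖ ^ 2 / 2) := by
  rw [charFun_apply, complexGaussian, integral_map measurable_complex_mk.aemeasurable
    (by fun_prop), div_self two_ne_zero]
  have h (x : ℝ × ℝ) : Complex.exp (⟪(⟨x.1, x.2⟩ : ℂ), t⟫ * Complex.I)
      = Complex.exp (t.re * x.1 * Complex.I) * Complex.exp (t.im * x.2 * Complex.I) := by
    rw [← Complex.exp_add, Complex.inner]
    congr 1
    simp
    ring
  simp_rw [h]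
  rw [integral_prod_mul (fun x : ℝ => Complex.exp (t.re * x * Complex.I))
    (fun x : ℝ => Complex.exp (t.im * x * Complex.I)), ← charFun_apply_real, ← charFun_apply_real,
    charFun_gaussianReal, charFun_gaussianReal, ← Complex.exp_add]
  congr 1
  rw [← Complex.ofReal_pow ‖t‖ 2, Complex.sq_norm, Complex.normSq_apply]
  simp
  ring

variable {ι κ : Type*} [Fintype ι] [Fintype κ]

/-- Variance `2` makes real and imaginary parts standard, so i.i.d. coordinates form the standard
Gaussian of the underlying real space. -/
lemma map_pi_complexGaussian_two :
    (Measure.pi fun _ : ι => complexGaussian 2).map (WithLp.toLp 2)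
      = stdGaussian (EuclideanSpace ℂ ι) := by
  have : IsProbabilityMeasure ((Measure.pi fun _ : ι => complexGaussian 2).map
      (WithLp.toLp 2 : _ → EuclideanSpace ℂ ι)) :=
    Measure.isProbabilityMeasure_map (by fun_prop)
  apply Measure.ext_of_charFun (E := EuclideanSpace ℂ ι)
  ext t
  rw [charFun_stdGaussian, charFun_pi]
  simp_rw [charFun_complexGaussian_two, ← Complex.exp_sum]
  rw [← Complex.ofReal_pow, EuclideanSpace.norm_sq_eq]
  simp [Finset.sum_div, neg_div]

lemma lintegral_exp_norm_sq_stdGaussian {θ : ℝ} (hθ : θ < 1) :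
    ∫⁻ x, ENNReal.ofReal (Real.exp (θ / 2 * ‖x‖ ^ 2)) ∂(stdGaussian (EuclideanSpace ℂ ι))
      = ENNReal.ofReal ((1 - θ)⁻¹ ^ Fintype.card ι) := by
  rw [← map_pi_complexGaussian_two, lintegral_map (by fun_prop) (by fun_prop)]
  have h (x : ι → ℂ) : Real.exp (θ / 2 * ‖(WithLp.toLp 2 x : EuclideanSpace ℂ ι)‖ ^ 2)
      = ∏ i, Real.exp (θ / 2 * ‖x i‖ ^ 2) := by
    rw [EuclideanSpace.norm_sq_eq, ← Real.exp_sum, Finset.mul_sum]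
  simp_rw [h]
  rw [← ofReal_integral_eq_lintegral_ofReal
    (Integrable.fintype_prod fun _ => integrable_exp_norm_sq_complexGaussian hθ)
    (Filter.Eventually.of_forall fun x => Finset.prod_nonneg fun i _ => (Real.exp_pos _).le),
    integral_fintype_prod_eq_prod (fun (_ : ι) (z : ℂ) => Real.exp (θ / 2 * ‖z‖ ^ 2))]
  simp [integral_exp_norm_sq_complexGaussian hθ]

/-- Linearise the square with an independent Gaussian `h`, integrate `x` out first, and use that
`S'` is a contraction. The exponent is thus the dimension of the target, which may be far smaller
than that of the source. -/
lemma lintegral_exp_norm_sq_le_of_adjoint {S : EuclideanSpace ℂ ι → EuclideanSpace ℂ κ}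
    {S' : EuclideanSpace ℂ κ → EuclideanSpace ℂ ι} (hS : Measurable S)
    (hadj : ∀ x h, ⟪S x, h⟫ = ⟪x, S' h⟫) (hnorm : ∀ h, ‖S' h‖ ≤ ‖h‖)
    {θ : ℝ} (hθ0 : 0 ≤ θ) (hθ : θ < 1) :
    ∫⁻ x, ENNReal.ofReal (Real.exp (θ / 2 * ‖S x‖ ^ 2)) ∂(stdGaussian (EuclideanSpace ℂ ι))
      ≤ ENNReal.ofReal ((1 - θ)⁻¹ ^ Fintype.card κ) := by
  have h1 (x : EuclideanSpace ℂ ι) : ENNReal.ofReal (Real.exp (θ / 2 * ‖S x‖ ^ 2))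
      = ∫⁻ h, ENNReal.ofReal (Real.exp ⟪√θ • S x, h⟫) ∂(stdGaussian (EuclideanSpace ℂ κ)) := by
    rw [lintegral_exp_inner_stdGaussian, norm_smul, mul_pow, Real.norm_eq_abs, sq_abs,
      Real.sq_sqrt hθ0]
    ring_nf
  simp_rw [h1]
  rw [lintegral_lintegral_swap (by fun_prop), ← lintegral_exp_norm_sq_stdGaussian hθ]
  refine lintegral_mono fun h => ?_
  have h2 (x : EuclideanSpace ℂ ι) : ⟪√θ • S x, h⟫ = ⟪√θ • S' h, x⟫ := by
    rw [real_inner_smul_left, real_inner_smul_left, hadj, real_inner_comm]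
  simp_rw [h2]
  rw [lintegral_exp_inner_stdGaussian, norm_smul, mul_pow, Real.norm_eq_abs, sq_abs,
    Real.sq_sqrt hθ0]
  refine ENNReal.ofReal_le_ofReal (Real.exp_le_exp.mpr ?_)
  have : ‖S' h‖ ^ 2 ≤ ‖h‖ ^ 2 := by gcongr; exact hnorm h
  nlinarith

end ComplexGaussian

/-! ### Gaussian measure of spherical caps, and tail bounds by a random direction. -/

section Cap

open scoped RealInnerProductSpace

lemma lintegral_Ioi_mul_exp_neg_sq {r : ℝ} (hr : 0 ≤ r) :
    ∫⁻ y in Set.Ioi (√r), ENNReal.ofReal (y * Real.exp (-(y ^ 2) / 2))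
      = ENNReal.ofReal (Real.exp (-r / 2)) := by
  have hd : ∀ y ∈ Set.Ici (√r), HasDerivAt (fun y : ℝ => -Real.exp (-(y ^ 2) / 2))
      (y * Real.exp (-(y ^ 2) / 2)) y := fun y _ => by
    refine (((hasDerivAt_pow 2 y).neg.div_const 2).exp).neg.congr_deriv ?_
    simp
    ring
  have hlim : Filter.Tendsto (fun y : ℝ => -Real.exp (-(y ^ 2) / 2)) Filter.atTop (nhds 0) := by
    rw [← neg_zero]
    refine Filter.Tendsto.neg (Real.tendsto_exp_atBot.comp ?_)
    refine Filter.Tendsto.atBot_div_const two_pos ?_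
    exact Filter.tendsto_neg_atTop_atBot.comp (Filter.tendsto_pow_atTop two_ne_zero)
  have hnn : ∀ y ∈ Set.Ioi (√r), 0 ≤ y * Real.exp (-(y ^ 2) / 2) := fun y hy =>
    mul_nonneg ((Real.sqrt_nonneg r).trans (le_of_lt hy)) (Real.exp_pos _).le
  rw [← ofReal_integral_eq_lintegral_ofReal
      (integrableOn_Ioi_deriv_of_nonneg' hd hnn hlim)
      ((ae_restrict_iff' measurableSet_Ioi).mpr (Filter.Eventually.of_forall hnn)),
    integral_Ioi_of_hasDerivAt_of_nonneg' hd hnn hlim, Real.sq_sqrt hr]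
  simp

lemma complexGaussian_two_norm_sq_gt {r : ℝ} (hr : 0 ≤ r) :
    complexGaussian 2 {z | r < ‖z‖ ^ 2} = ENNReal.ofReal (Real.exp (-r / 2)) := by
  have hms : MeasurableSet {z : ℂ | r < ‖z‖ ^ 2} := measurableSet_lt (by fun_prop) (by fun_prop)
  set A : Set (ℝ × ℝ) := {x | r < x.1 ^ 2 + x.2 ^ 2} with hA
  have hmA : MeasurableSet A := measurableSet_lt (by fun_prop) (by fun_prop)
  have hpre : (fun x : ℝ × ℝ => (⟨x.1, x.2⟩ : ℂ)) ⁻¹' {z : ℂ | r < ‖z‖ ^ 2} = A := by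
    ext x
    rw [Set.mem_preimage, Set.mem_ofPred_eq, Complex.sq_norm, Complex.normSq_mk, ← sq, ← sq]
    rfl
  rw [complexGaussian, Measure.map_apply measurable_complex_mk hms, hpre, div_self two_ne_zero,
    gaussianReal_of_var_ne_zero _ one_ne_zero, prod_withDensity (by fun_prop) (by fun_prop),
    withDensity_apply _ hmA, ← lintegral_indicator hmA, ← Measure.volume_eq_prod,
    ← lintegral_comp_polarCoord_symm]
  have hval : ∀ p ∈ polarCoord.target, ENNReal.ofReal p.1 • A.indicator
        (fun z : ℝ × ℝ => gaussianPDF 0 1 z.1 * gaussianPDF 0 1 z.2) (polarCoord.symm p)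
      = (Set.Ioi (√r)).indicator
          (fun y => ENNReal.ofReal (y * Real.exp (-(y ^ 2) / 2))) p.1
        * ENNReal.ofReal (2 * Real.pi)⁻¹ := by
    intro p hp
    have hp1 : 0 < p.1 := hp.1
    have hsq : (polarCoord.symm p).1 ^ 2 + (polarCoord.symm p).2 ^ 2 = p.1 ^ 2 := by
      simp only [polarCoord_symm_apply]
      linear_combination p.1 ^ 2 * Real.cos_sq_add_sin_sq p.2
    have hmem : polarCoord.symm p ∈ A ↔ p.1 ∈ Set.Ioi (√r) := by
      rw [hA, Set.mem_ofPred_eq, hsq, Set.mem_Ioi, Real.sqrt_lt' hp1]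
    by_cases h : p.1 ∈ Set.Ioi (√r)
    · rw [Set.indicator_of_mem (hmem.mpr h), Set.indicator_of_mem h, smul_eq_mul]
      simp only [gaussianPDF]
      rw [← ENNReal.ofReal_mul (gaussianPDFReal_nonneg _ _ _), ← ENNReal.ofReal_mul hp1.le,
        ← ENNReal.ofReal_mul (by positivity)]
      congr 1
      simp only [gaussianPDFReal, NNReal.coe_one, mul_one, sub_zero]
      have h2 : (√(2 * Real.pi))⁻¹ * (√(2 * Real.pi))⁻¹ = (2 * Real.pi)⁻¹ := by
        rw [← mul_inv, Real.mul_self_sqrt (by positivity)]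
      rw [← hsq, neg_add, add_div, Real.exp_add, ← h2]
      ring
    · rw [Set.indicator_of_notMem (fun h' => h (hmem.mp h')), Set.indicator_of_notMem h]
      simp
  rw [setLIntegral_congr_fun polarCoord.open_target.measurableSet hval, polarCoord_target,
    Measure.volume_eq_prod, ← Measure.prod_restrict,
    lintegral_prod_mul (f := (Set.Ioi (√r)).indicator
      (fun y => ENNReal.ofReal (y * Real.exp (-(y ^ 2) / 2))))
      (g := fun _ => ENNReal.ofReal (2 * Real.pi)⁻¹)
      ((Measurable.indicator (by fun_prop) measurableSet_Ioi).aemeasurable) (by fun_prop),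
    lintegral_indicator measurableSet_Ioi, Measure.restrict_restrict measurableSet_Ioi,
    Set.inter_eq_left.mpr (Set.Ioi_subset_Ioi (Real.sqrt_nonneg r)),
    lintegral_Ioi_mul_exp_neg_sq hr]
  simp only [lintegral_const, Measure.restrict_apply MeasurableSet.univ, Set.univ_inter,
    Real.volume_Ioo]
  rw [← ENNReal.ofReal_mul (by positivity), show (2 * Real.pi)⁻¹ * (Real.pi - -Real.pi) = 1 by
    field_simp; ring]
  simp

/-- Given the other coordinates, `‖x 0‖ ^ 2` is exponential, so the probability is a chi-square
Laplace transform, evaluated at the negative parameter `-κ`. -/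
lemma pi_complexGaussian_two_cap (m : ℕ) {κ : ℝ} (hκ : 0 ≤ κ) :
    (Measure.pi fun _ : Fin (m + 1) => complexGaussian 2)
        {x | κ * ∑ i : Fin m, ‖x i.succ‖ ^ 2 < ‖x 0‖ ^ 2}
      = ENNReal.ofReal ((1 + κ)⁻¹ ^ m) := by
  have hmp := measurePreserving_piFinSuccAbove (fun _ : Fin (m + 1) => complexGaussian 2) 0
  set A : Set (ℂ × (Fin m → ℂ)) := {p | κ * ∑ i : Fin m, ‖p.2 i‖ ^ 2 < ‖p.1‖ ^ 2} with hA
  have hmA : MeasurableSet A := measurableSet_lt (by fun_prop) (by fun_prop)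
  have hpre : {x : Fin (m + 1) → ℂ | κ * ∑ i : Fin m, ‖x i.succ‖ ^ 2 < ‖x 0‖ ^ 2}
      = (MeasurableEquiv.piFinSuccAbove (fun _ : Fin (m + 1) => ℂ) 0) ⁻¹' A := by
    ext x
    simp [hA, MeasurableEquiv.piFinSuccAbove, Fin.insertNthEquiv, Fin.tail]
  rw [hpre, hmp.measure_preimage hmA.nullMeasurableSet, Measure.prod_apply_symm hmA]
  have h (y : Fin m → ℂ) : complexGaussian 2 ((fun x => (x, y)) ⁻¹' A)
      = ENNReal.ofReal (Real.exp ((-κ) / 2 * ‖(WithLp.toLp 2 y : EuclideanSpace ℂ (Fin m))‖ ^ 2)) := by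
    have : ((fun x => (x, y)) ⁻¹' A) = {z : ℂ | κ * ∑ i : Fin m, ‖y i‖ ^ 2 < ‖z‖ ^ 2} := rfl
    rw [this, complexGaussian_two_norm_sq_gt (by positivity), EuclideanSpace.norm_sq_eq]
    congr 2
    ring
  simp_rw [h]
  have h2 := lintegral_exp_norm_sq_stdGaussian (ι := Fin m) (θ := -κ) (by linarith)
  rw [← map_pi_complexGaussian_two, lintegral_map (by fun_prop) (by fun_prop)] at h2
  simpa using h2

lemma real_inner_eq_re {ι : Type*} [Fintype ι] (x y : EuclideanSpace ℂ ι) :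
    ⟪x, y⟫ = (inner ℂ x y).re := by
  simp [PiLp.inner_apply, Complex.inner]

/-- By unitary invariance `v` may be taken as the first basis vector. The cap is then the event
above with `κ = (1 - δ) / δ`. -/
lemma stdGaussian_cap (m : ℕ) {δ : ℝ} (hδ : 0 < δ) (hδ1 : δ ≤ 1)
    {v : EuclideanSpace ℂ (Fin (m + 1))} (hv : ‖v‖ = 1) :
    stdGaussian (EuclideanSpace ℂ (Fin (m + 1)))
      {x | (1 - δ) * ‖x‖ ^ 2 < ‖inner ℂ v x‖ ^ 2} = ENNReal.ofReal (δ ^ m) := by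
  obtain ⟨b, hb⟩ := Orthonormal.exists_orthonormalBasis_extension_of_card_eq (𝕜 := ℂ)
    (ι := Fin (m + 1)) (E := EuclideanSpace ℂ (Fin (m + 1))) (by simp) (v := fun _ => v) (s := {0})
    ⟨fun i => hv, fun i j hij => absurd (Subsingleton.elim i j) hij⟩
  have hb0 : b 0 = v := hb 0 rfl
  set A : Set (EuclideanSpace ℂ (Fin (m + 1))) := {x | (1 - δ) * ‖x‖ ^ 2 < ‖x 0‖ ^ 2} with hA
  have hmA : MeasurableSet A := measurableSet_lt (by fun_prop) (by fun_prop)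
  have hpre : {x | (1 - δ) * ‖x‖ ^ 2 < ‖inner ℂ v x‖ ^ 2} = b.repr ⁻¹' A := by
    ext x
    simp [hA, b.repr_apply_apply, hb0]
  have hmeas : Measurable b.repr := b.repr.continuous.measurable
  rw [hpre, ← Measure.map_apply hmeas hmA,
    map_stdGaussian_of_isometric_adjoint (T' := b.repr.symm) hmeas ?_ (fun t => by simp),
    ← map_pi_complexGaussian_two, Measure.map_apply (by fun_prop) hmA]
  · have hκ : 0 ≤ (1 - δ) / δ := div_nonneg (by linarith) hδ.le
    have := pi_complexGaussian_two_cap m hκ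
    rw [show (1 + (1 - δ) / δ)⁻¹ = δ by field_simp; ring] at this
    rw [← this]
    congr 1
    ext x
    simp only [hA, Set.mem_preimage, Set.mem_ofPred_eq, EuclideanSpace.norm_sq_eq,
      Fin.sum_univ_succ]
    rw [div_mul_eq_mul_div, div_lt_iff₀ hδ]
    constructor <;> intro h <;> linarith
  · intro x t
    rw [real_inner_eq_re, real_inner_eq_re]
    nth_rw 1 [← b.repr.apply_symm_apply t]
    rw [LinearIsometryEquiv.inner_map_map]

/-- Markov's inequality over a random direction: an event on which `Q ω` is large on a whole
spherical cap has small probability. -/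
lemma measure_le_of_large_on_cap {Ω : Type*} [MeasurableSpace Ω] {ν : Measure Ω} [SFinite ν]
    {M : ℕ} (hM : 0 < M) {Q : Ω → EuclideanSpace ℂ (Fin M) → ℝ}
    (hQ : Measurable (Function.uncurry Q)) {C δ t : ℝ} (hδ : 0 < δ) (hδ1 : δ ≤ 1) (hC0 : 0 ≤ C)
    (hC : ∀ u, ‖u‖ = 1 → ∫⁻ ω, ENNReal.ofReal (Real.exp (Q ω u)) ∂ν ≤ ENNReal.ofReal C)
    {B : Set Ω} (hB : ∀ ω ∈ B, ∃ v, ‖v‖ = 1 ∧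
      ∀ u, ‖u‖ = 1 → 1 - δ ≤ ‖inner ℂ v u‖ ^ 2 → t ≤ Q ω u) :
    ν B ≤ ENNReal.ofReal (C * Real.exp (-t) * δ⁻¹ ^ M) := by
  obtain ⟨m, rfl⟩ : ∃ m, M = m + 1 := ⟨M - 1, by omega⟩
  set Γ := stdGaussian (EuclideanSpace ℂ (Fin (m + 1)))
  -- The value at `0` is an arbitrary unit vector, so that `dir x` is a unit vector for every `x`.
  let dir : EuclideanSpace ℂ (Fin (m + 1)) → EuclideanSpace ℂ (Fin (m + 1)) := fun x =>
    if x = 0 then EuclideanSpace.single 0 1 else ((‖x‖ : ℂ)⁻¹) • x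
  have hdir : Measurable dir := Measurable.ite (measurableSet_singleton 0) measurable_const
    (by fun_prop)
  have hunit (x) : ‖dir x‖ = 1 := by
    by_cases hx : x = 0
    · simp [dir, hx]
    · simp [dir, hx, norm_smul]
  have hQd : Measurable fun p : Ω × EuclideanSpace ℂ (Fin (m + 1)) =>
      ENNReal.ofReal (Real.exp (Q p.1 (dir p.2))) :=
    ((Real.measurable_exp.comp (hQ.comp (measurable_fst.prodMk (hdir.comp measurable_snd))))).ennreal_ofReal
  set Φ : Ω → ENNReal := fun ω => ∫⁻ x, ENNReal.ofReal (Real.exp (Q ω (dir x))) ∂Γ with hΦ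
  have hΦm : Measurable Φ := hQd.lintegral_prod_right'
  have hint : ∫⁻ ω, Φ ω ∂ν ≤ ENNReal.ofReal C := by
    rw [hΦ, lintegral_lintegral_swap hQd.aemeasurable]
    calc _ ≤ ∫⁻ _, ENNReal.ofReal C ∂Γ := lintegral_mono fun x => hC _ (hunit x)
      _ = _ := by simp
  have hlow : ∀ ω ∈ B, ENNReal.ofReal (Real.exp t * δ ^ m) ≤ Φ ω := by
    intro ω hω
    obtain ⟨v, hv, hcap⟩ := hB ω hω
    set A : Set (EuclideanSpace ℂ (Fin (m + 1))) := {x | (1 - δ) * ‖x‖ ^ 2 < ‖inner ℂ v x‖ ^ 2}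
    have hmA : MeasurableSet A := measurableSet_lt (by fun_prop) (by fun_prop)
    rw [ENNReal.ofReal_mul (Real.exp_pos _).le, ← stdGaussian_cap m hδ hδ1 hv,
      ← setLIntegral_const]
    refine (setLIntegral_mono' hmA fun x hx => ?_).trans (setLIntegral_le_lintegral A _)
    refine ENNReal.ofReal_le_ofReal (Real.exp_le_exp.mpr (hcap _ (hunit x) ?_))
    have hx' : (1 - δ) * ‖x‖ ^ 2 < ‖inner ℂ v x‖ ^ 2 := hx
    have hx0 : x ≠ 0 := by rintro rfl; simp at hx'
    have hn : 0 < ‖x‖ := norm_pos_iff.mpr hx0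
    simp only [dir, hx0, if_false, inner_smul_right, norm_mul, norm_inv, Complex.norm_real,
      norm_norm, mul_pow, inv_pow]
    rw [inv_mul_eq_div, le_div_iff₀ (by positivity)]
    exact hx'.le
  have hpos : 0 < Real.exp t * δ ^ m := by positivity
  -- Markov's inequality is applied to a superlevel set of `Φ` containing `B`, so `B` need not be
  -- measurable.
  have hmk := mul_meas_ge_le_lintegral (μ := ν) hΦm (ENNReal.ofReal (Real.exp t * δ ^ m))
  have h1 : ENNReal.ofReal (Real.exp t * δ ^ m) * ν B ≤ ENNReal.ofReal C :=
    (mul_le_mul_right (measure_mono hlow) _).trans (hmk.trans hint)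
  have h2 : ν B ≤ ENNReal.ofReal C / ENNReal.ofReal (Real.exp t * δ ^ m) := by
    rw [ENNReal.le_div_iff_mul_le (Or.inl (by simpa using hpos)) (Or.inl (by simp)), mul_comm]
    exact h1
  refine h2.trans ?_
  rw [← ENNReal.ofReal_div_of_pos hpos]
  refine ENNReal.ofReal_le_ofReal ?_
  rw [div_eq_mul_inv, mul_inv, ← Real.exp_neg, ← inv_pow, mul_assoc]
  -- The cap has measure `δ ^ m` with `m = M - 1`; a factor `δ⁻¹ ≥ 1` is given away.
  gcongr
  · exact (one_le_inv₀ hδ).mpr hδ1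
  · omega

end Cap

/-! ### Norms of Gaussian random matrices. -/

section RandomMatrix

open scoped RealInnerProductSpace

/-- A symmetric operator is, up to sign, large on a cap around a suitable unit vector. -/
lemma exists_large_on_cap {V : Type*} [NormedAddCommGroup V] [InnerProductSpace ℂ V]
    [FiniteDimensional ℂ V] (hV : 0 < Module.finrank ℂ V) {T : V →ₗ[ℂ] V} (hT : T.IsSymmetric) :
    ∃ ε : ℝ, (ε = 1 ∨ ε = -1) ∧ ∃ v : V, ‖v‖ = 1 ∧ ∀ u : V, ‖u‖ = 1 →
      ‖LinearMap.toContinuousLinearMap T‖ * (2 * ‖inner ℂ v u‖ ^ 2 - 1)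
        ≤ ε * (inner ℂ u (T u)).re := by
  set b := hT.eigenvectorBasis rfl
  set lam := hT.eigenvalues rfl
  have hTb (u : V) (i) : inner ℂ (b i) (T u) = lam i * inner ℂ (b i) u := by
    rw [← hT, hT.apply_eigenvectorBasis, inner_smul_left]
    simp [lam, b]
  have : Nonempty (Fin (Module.finrank ℂ V)) := ⟨⟨0, hV⟩⟩
  obtain ⟨i, -, hi⟩ := Finset.exists_max_image Finset.univ (fun i => |lam i|)
    Finset.univ_nonempty
  have hnorm : ‖LinearMap.toContinuousLinearMap T‖ ≤ |lam i| := by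
    refine ContinuousLinearMap.opNorm_le_bound _ (abs_nonneg _) fun u => ?_
    refine le_of_sq_le_sq ?_ (by positivity)
    change ‖T u‖ ^ 2 ≤ _
    rw [← b.sum_sq_norm_inner_right (T u), mul_pow, ← b.sum_sq_norm_inner_right u, Finset.mul_sum]
    refine Finset.sum_le_sum fun j _ => ?_
    rw [hTb, norm_mul, mul_pow, Complex.norm_real, Real.norm_eq_abs]
    exact mul_le_mul_of_nonneg_right
      (pow_le_pow_left₀ (abs_nonneg _) (hi j (Finset.mem_univ j)) 2) (by positivity)
  have hquad (u : V) : (inner ℂ u (T u)).re = ∑ j, lam j * ‖inner ℂ (b j) u‖ ^ 2 := by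
    rw [← b.sum_inner_mul_inner u (T u), Complex.re_sum]
    refine Finset.sum_congr rfl fun j _ => ?_
    rw [hTb, mul_left_comm, ← inner_conj_symm u (b j), ← Complex.normSq_eq_conj_mul_self,
      Complex.normSq_eq_norm_sq, ← Complex.ofReal_mul, Complex.ofReal_re]
  obtain ⟨ε, hε, hεi⟩ : ∃ ε : ℝ, (ε = 1 ∨ ε = -1) ∧ ε * lam i = |lam i| := by
    rcases abs_cases (lam i) with h | h
    · exact ⟨1, Or.inl rfl, by linarith [h.1]⟩
    · exact ⟨-1, Or.inr rfl, by linarith [h.1]⟩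
  have hεabs : |ε| = 1 := by rcases hε with rfl | rfl <;> simp
  refine ⟨ε, hε, b i, b.norm_eq_one i, fun u hu => ?_⟩
  have hsum := b.sum_sq_norm_inner_right u
  rw [hu, ← Finset.add_sum_erase _ _ (Finset.mem_univ i)] at hsum
  set β := ‖inner ℂ (b i) u‖ ^ 2
  have hβ : 0 ≤ β := by positivity
  rw [hquad, ← Finset.add_sum_erase _ _ (Finset.mem_univ i), mul_add, ← mul_assoc, hεi]
  -- The remaining eigenvalues are at most `|lam i|` in modulus, so they cancel at most `|lam i| *
  -- (1 - β)` of the main term `|lam i| * β`.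
  have hrest : -(|lam i| * (1 - β))
      ≤ ε * ∑ j ∈ Finset.univ.erase i, lam j * ‖inner ℂ (b j) u‖ ^ 2 := by
    rw [show 1 - β = ∑ j ∈ Finset.univ.erase i, ‖inner ℂ (b j) u‖ ^ 2 by linarith,
      Finset.mul_sum, Finset.mul_sum, ← Finset.sum_neg_distrib]
    refine Finset.sum_le_sum fun j _ => ?_
    have h1 : |ε * lam j| ≤ |lam i| := by
      rw [abs_mul, hεabs, one_mul]; exact hi j (Finset.mem_univ j)
    have h2 := (abs_le.mp h1).1
    have h3 : 0 ≤ ‖inner ℂ (b j) u‖ ^ 2 := by positivity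
    nlinarith
  have hnorm' : ‖LinearMap.toContinuousLinearMap T‖ = |lam i| := by
    refine le_antisymm hnorm ?_
    have := (LinearMap.toContinuousLinearMap T).le_opNorm (b i)
    rw [b.norm_eq_one, mul_one, LinearMap.coe_toContinuousLinearMap',
      hT.apply_eigenvectorBasis, norm_smul] at this
    simpa [b] using this
  rw [hnorm']
  linarith

variable {M L K : ℕ}

/-- The vector `Aᴴ u`, where `A` is the matrix with entries `g`. -/
def adjMulVec (g : EuclideanSpace ℂ (Fin M × Fin L)) (u : EuclideanSpace ℂ (Fin M)) :
    EuclideanSpace ℂ (Fin L) :=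
  WithLp.toLp 2 fun l => ∑ m, starRingEnd ℂ (g (m, l)) * u m

lemma measurable_adjMulVec {α : Type*} [MeasurableSpace α]
    {g : α → EuclideanSpace ℂ (Fin M × Fin L)} {u : α → EuclideanSpace ℂ (Fin M)}
    (hg : Measurable g) (hu : Measurable u) : Measurable fun a => adjMulVec (g a) (u a) := by
  unfold adjMulVec
  refine (WithLp.measurable_toLp 2 _).comp (measurable_pi_lambda _ fun l =>
    Finset.measurable_sum _ fun m _ => Measurable.mul (Complex.continuous_conj.measurable.comp ?_) ?_)
  · fun_prop
  · fun_prop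

/-- The map is conjugate-linear in `g`, so its adjoint is taken for the real inner product; it is
isometric because `u` is a unit vector. Quadratic forms of a Wishart matrix in a fixed direction are
therefore chi-square. -/
lemma map_adjMulVec {u : EuclideanSpace ℂ (Fin M)} (hu : ‖u‖ = 1) :
    (stdGaussian (EuclideanSpace ℂ (Fin M × Fin L))).map (fun g => adjMulVec g u)
      = stdGaussian (EuclideanSpace ℂ (Fin L)) := by
  have hm : Measurable fun g : EuclideanSpace ℂ (Fin M × Fin L) => adjMulVec g u :=
    measurable_adjMulVec measurable_id measurable_const
  refine map_stdGaussian_of_isometric_adjoint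
    (T' := fun t => WithLp.toLp 2 fun q => starRingEnd ℂ (t q.2) * u q.1) hm (fun g t => ?_)
    (fun t => ?_)
  · simp only [PiLp.inner_apply, adjMulVec, Complex.inner, Fintype.sum_prod_type, map_sum,
      Finset.mul_sum, Complex.re_sum]
    rw [Finset.sum_comm]
    refine Finset.sum_congr rfl fun m _ => Finset.sum_congr rfl fun l _ => ?_
    rw [← Complex.conj_re]
    congr 1
    simp
    ring
  · rw [← sq_eq_sq₀ (norm_nonneg _) (norm_nonneg _), EuclideanSpace.norm_sq_eq,
      EuclideanSpace.norm_sq_eq, Fintype.sum_prod_type]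
    simp only [norm_mul, RCLike.norm_conj, mul_pow]
    simp_rw [← Finset.sum_mul]
    rw [← Finset.mul_sum, ← EuclideanSpace.norm_sq_eq u, hu]
    simp

/-- The matrix with entries `g`. -/
def matOf (g : Fin M × Fin L → ℂ) : Matrix (Fin M) (Fin L) ℂ := Matrix.of fun i l => g (i, l)

lemma toEuclideanLin_conjTranspose_matOf (g : EuclideanSpace ℂ (Fin M × Fin L))
    (u : EuclideanSpace ℂ (Fin M)) :
    Matrix.toEuclideanLin (matOf g)ᴴ u = adjMulVec g u := by
  ext l
  simp [adjMulVec, matOf, Matrix.toLpLin_apply, Matrix.mulVec, dotProduct,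
    Matrix.conjTranspose_apply]

lemma re_inner_conjTranspose_mul_self {m n : ℕ} (A : Matrix (Fin m) (Fin n) ℂ)
    (u : EuclideanSpace ℂ (Fin n)) :
    (inner ℂ u (Matrix.toEuclideanLin (Aᴴ * A) u)).re = ‖Matrix.toEuclideanLin A u‖ ^ 2 := by
  have h : Matrix.toEuclideanLin (Aᴴ * A) u
      = LinearMap.adjoint (Matrix.toEuclideanLin A) (Matrix.toEuclideanLin A u) := by
    rw [← Matrix.toEuclideanLin_conjTranspose_eq_adjoint]
    simp [Matrix.toLpLin_apply, Matrix.mulVec_mulVec]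
  rw [h, LinearMap.adjoint_inner_right, inner_self_eq_norm_sq_to_K]
  norm_cast

lemma eight_le_exp : (8 : ℝ) ≤ Real.exp (9 / 4) := by
  have h : (8 : ℝ) ^ 4 ≤ Real.exp (9 / 4) ^ 4 := by
    rw [← Real.exp_nat_mul, show ((4 : ℕ) : ℝ) * (9 / 4) = (9 : ℕ) * 1 by norm_num, Real.exp_nat_mul]
    calc (8 : ℝ) ^ 4 ≤ 2.7 ^ 9 := by norm_num
      _ ≤ _ := by gcongr; linarith [Real.exp_one_gt_d9]
  exact le_of_pow_le_pow_left₀ (by norm_num) (Real.exp_pos _).le h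

lemma sixteen_le_exp : (16 : ℝ) ≤ Real.exp (23 / 8) := by
  have h : (16 : ℝ) ^ 8 ≤ Real.exp (23 / 8) ^ 8 := by
    rw [← Real.exp_nat_mul, show ((8 : ℕ) : ℝ) * (23 / 8) = (23 : ℕ) * 1 by norm_num,
      Real.exp_nat_mul]
    calc (16 : ℝ) ^ 8 ≤ 2.7 ^ 23 := by norm_num
      _ ≤ _ := by gcongr; linarith [Real.exp_one_gt_d9]
  exact le_of_pow_le_pow_left₀ (by norm_num) (Real.exp_pos _).le h

/-- Since `(1 - x)(1 + x + x²) = 1 - x³`, the bound `1 + y ≤ exp y` suffices for negative `x`;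
positive `x` needs the quadratic term of the exponential. -/
lemma inv_one_sub_le_exp {x : ℝ} (hx : |x| ≤ 1 / 2) : (1 - x)⁻¹ ≤ Real.exp (x + x ^ 2) := by
  obtain ⟨h1, h2⟩ := abs_le.mp hx
  have hpos : 0 < 1 - x := by linarith
  rw [inv_le_iff_one_le_mul₀ hpos]
  rcases le_or_gt 0 x with h0 | h0
  · refine le_trans ?_ (mul_le_mul_of_nonneg_right
      (Real.quadratic_le_exp_of_nonneg (by positivity)) hpos.le)
    nlinarith [pow_nonneg h0 3, mul_nonneg (pow_nonneg h0 2) (by linarith : 0 ≤ 1 / 2 - x),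
      mul_nonneg (pow_nonneg h0 3) (by linarith : 0 ≤ 1 / 2 - x),
      mul_nonneg (pow_nonneg h0 4) (by linarith : 0 ≤ 1 / 2 - x)]
  · refine le_trans ?_ (mul_le_mul_of_nonneg_right (Real.add_one_le_exp (x + x ^ 2)) hpos.le)
    nlinarith [pow_pos (neg_pos.mpr h0) 3]

/-- In a fixed direction the exponential moment is `e^{-θL} (1 - θ)^{-L} ≤ e^{θ²L} ≤ e^{M/4}`. With
`8 ≤ e^{9/4}` the exponents add up to `M/4 - 3M + 9M/4 = -M/2`. The two signs of `θ` serve the two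
signs of the deviation. -/
lemma stdGaussian_wishart_cap (hM : 0 < M) {θ c : ℝ} (hθ : |θ| ≤ 1 / 2)
    (hθL : θ ^ 2 * L ≤ M / 4) (hc : 3 * M ≤ c) :
    stdGaussian (EuclideanSpace ℂ (Fin M × Fin L)) {g | ∃ v, ‖v‖ = 1 ∧ ∀ u, ‖u‖ = 1 →
      1 - 1 / 8 ≤ ‖inner ℂ v u‖ ^ 2 → c ≤ θ * (‖adjMulVec g u‖ ^ 2 / 2 - L)}
      ≤ ENNReal.ofReal (Real.exp (-(M : ℝ) / 2)) := by
  have hm : Measurable (Function.uncurry fun (g : EuclideanSpace ℂ (Fin M × Fin L)) u =>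
      θ * (‖adjMulVec g u‖ ^ 2 / 2 - L)) := by
    have := measurable_adjMulVec (M := M) (L := L) measurable_fst measurable_snd
    exact ((((this.norm).pow_const 2).div_const 2).sub_const _).const_mul θ
  refine (measure_le_of_large_on_cap (ν := stdGaussian (EuclideanSpace ℂ (Fin M × Fin L))) hM
    hm (δ := 1 / 8) (C := Real.exp (M / 4)) (t := c) (by norm_num) (by norm_num)
    (Real.exp_pos _).le (fun u hu => ?_) (fun g hg => hg)).trans ?_
  · have hmu : Measurable fun g : EuclideanSpace ℂ (Fin M × Fin L) => adjMulVec g u :=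
      measurable_adjMulVec measurable_id measurable_const
    have h1 : ∫⁻ g, ENNReal.ofReal (Real.exp (θ * (‖adjMulVec g u‖ ^ 2 / 2 - L)))
          ∂(stdGaussian (EuclideanSpace ℂ (Fin M × Fin L)))
        = ∫⁻ x, ENNReal.ofReal (Real.exp (θ * (‖x‖ ^ 2 / 2 - L)))
          ∂(stdGaussian (EuclideanSpace ℂ (Fin L))) := by
      rw [← map_adjMulVec hu, lintegral_map (by fun_prop) hmu]
    have h2 (x : EuclideanSpace ℂ (Fin L)) :
        ENNReal.ofReal (Real.exp (θ * (‖x‖ ^ 2 / 2 - L)))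
        = ENNReal.ofReal (Real.exp (-(θ * L))) * ENNReal.ofReal (Real.exp (θ / 2 * ‖x‖ ^ 2)) := by
      rw [← ENNReal.ofReal_mul (Real.exp_pos _).le, ← Real.exp_add]
      ring_nf
    rw [h1]
    simp_rw [h2]
    have hθ1 := (abs_le.mp hθ).2
    rw [lintegral_const_mul _ (by fun_prop), lintegral_exp_norm_sq_stdGaussian (by linarith),
      ← ENNReal.ofReal_mul (Real.exp_pos _).le]
    refine ENNReal.ofReal_le_ofReal ?_
    have h3 : (1 - θ)⁻¹ ^ Fintype.card (Fin L) ≤ Real.exp (L * (θ + θ ^ 2)) := by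
      rw [Fintype.card_fin, Real.exp_nat_mul]
      exact pow_le_pow_left₀ (inv_nonneg.mpr (by linarith)) (inv_one_sub_le_exp hθ) L
    calc _ ≤ Real.exp (-(θ * L)) * Real.exp (L * (θ + θ ^ 2)) := by gcongr
      _ = Real.exp (θ ^ 2 * L) := by rw [← Real.exp_add]; ring_nf
      _ ≤ _ := by gcongr
  · refine ENNReal.ofReal_le_ofReal ?_
    calc Real.exp (M / 4) * Real.exp (-c) * (1 / 8 : ℝ)⁻¹ ^ M
        ≤ Real.exp (M / 4) * Real.exp (-(3 * M)) * Real.exp (9 / 4) ^ M := by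
          gcongr
          simpa using eight_le_exp
      _ = _ := by
        rw [← Real.exp_nat_mul, ← Real.exp_add, ← Real.exp_add]
        ring_nf

lemma norm_toContinuousLinearMap_toEuclideanLin {m n : ℕ} (A : Matrix (Fin m) (Fin n) ℂ) :
    ‖LinearMap.toContinuousLinearMap (Matrix.toEuclideanLin A)‖ = ‖A‖ := rfl

/-- Deviation of a Wishart matrix, with entries of variance `2`. -/
lemma stdGaussian_wishart (hM : 0 < M) (hL : 0 < L) :
    stdGaussian (EuclideanSpace ℂ (Fin M × Fin L))
      {g | 8 * max (√(M * L)) M < ‖(1 / 2 : ℂ) • (matOf g * (matOf g)ᴴ) - (L : ℂ) • 1‖}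
      ≤ ENNReal.ofReal (2 * Real.exp (-(M : ℝ) / 2)) := by
  have hM' : (0 : ℝ) < M := by exact_mod_cast hM
  have hL' : (0 : ℝ) < L := by exact_mod_cast hL
  set h : ℝ := 8 * max (√(M * L)) M with hh
  -- Chosen so that `θ * h = 4 * M` in both regimes `M ≤ L` and `L ≤ M`, while `θ ≤ 1 / 2` and `θ ^
  -- 2 * L ≤ M / 4`.
  set θ : ℝ := 1 / 2 * min (√(M / L)) 1 with hθ
  have hθ0 : 0 ≤ θ := by positivity
  have hθh : θ * h = 4 * M := by
    rcases le_total M L with hML | hML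
    · have hML' : (M : ℝ) ≤ L := by exact_mod_cast hML
      have h1 : √((M : ℝ) / L) ≤ 1 := by
        rw [Real.sqrt_le_one]; exact (div_le_one hL').mpr hML'
      have h2 : (M : ℝ) ≤ √(M * L) := Real.le_sqrt_of_sq_le (by nlinarith)
      rw [hθ, hh, min_eq_left h1, max_eq_left h2]
      have : √((M : ℝ) / L) * √(M * L) = M := by
        rw [← Real.sqrt_mul (by positivity), show (M : ℝ) / L * (M * L) = M ^ 2 by field_simp,
          Real.sqrt_sq hM'.le]
      linear_combination 4 * this
    · have hML' : (L : ℝ) ≤ M := by exact_mod_cast hML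
      have h1 : 1 ≤ √((M : ℝ) / L) := by
        rw [Real.one_le_sqrt]; exact (one_le_div hL').mpr hML'
      have h2 : √((M : ℝ) * L) ≤ M := by
        rw [Real.sqrt_le_left hM'.le]; nlinarith
      rw [hθ, hh, min_eq_right h1, max_eq_right h2]
      ring
  have hθ2 : |θ| ≤ 1 / 2 := by
    rw [abs_of_nonneg hθ0, hθ]
    linarith [min_le_right (√((M : ℝ) / L)) 1]
  have hθL : θ ^ 2 * L ≤ M / 4 := by
    have h1 : θ ≤ 1 / 2 * √((M : ℝ) / L) := by
      rw [hθ]; linarith [min_le_left (√((M : ℝ) / L)) 1]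
    calc θ ^ 2 * (L : ℝ) ≤ (1 / 2 * √((M : ℝ) / L)) ^ 2 * (L : ℝ) := by gcongr
      _ = (M : ℝ) / 4 := by
        rw [mul_pow, Real.sq_sqrt (by positivity)]
        have := hL'.ne'
        field_simp
        norm_num
  have hsub : {g : EuclideanSpace ℂ (Fin M × Fin L) |
        h < ‖(1 / 2 : ℂ) • (matOf g * (matOf g)ᴴ) - (L : ℂ) • 1‖}
      ⊆ {g | ∃ v, ‖v‖ = 1 ∧ ∀ u, ‖u‖ = 1 → 1 - 1 / 8 ≤ ‖inner ℂ v u‖ ^ 2 →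
          3 * (M : ℝ) ≤ θ * (‖adjMulVec g u‖ ^ 2 / 2 - L)}
        ∪ {g | ∃ v, ‖v‖ = 1 ∧ ∀ u, ‖u‖ = 1 → 1 - 1 / 8 ≤ ‖inner ℂ v u‖ ^ 2 →
          3 * (M : ℝ) ≤ (-θ) * (‖adjMulVec g u‖ ^ 2 / 2 - L)} := by
    intro g hg
    rw [Set.mem_ofPred_eq] at hg
    set H := (1 / 2 : ℂ) • (matOf g * (matOf g)ᴴ) - (L : ℂ) • 1 with hH
    have hherm : H.IsHermitian := by
      rw [Matrix.IsHermitian, hH]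
      simp [Matrix.conjTranspose_smul, Matrix.conjTranspose_sub]
    obtain ⟨ε, hε, v, hv, hcap⟩ := exists_large_on_cap (by simpa using hM)
      (Matrix.isSymmetric_toEuclideanLin_iff.mpr hherm)
    rw [norm_toContinuousLinearMap_toEuclideanLin] at hcap
    have hq (u : EuclideanSpace ℂ (Fin M)) (hu : ‖u‖ = 1) :
        (inner ℂ u (Matrix.toEuclideanLin H u)).re = ‖adjMulVec g u‖ ^ 2 / 2 - L := by
      have h1 := re_inner_conjTranspose_mul_self (matOf g)ᴴ u
      rw [Matrix.conjTranspose_conjTranspose, toEuclideanLin_conjTranspose_matOf] at h1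
      rw [hH, map_sub, map_smul, map_smul, LinearMap.sub_apply, LinearMap.smul_apply,
        LinearMap.smul_apply, inner_sub_right, inner_smul_right, inner_smul_right]
      have h2 : Matrix.toEuclideanLin (1 : Matrix (Fin M) (Fin M) ℂ) u = u := by
        ext; simp
      rw [h2, inner_self_eq_norm_sq_to_K, hu, ← h1]
      simp
      ring
    have key : ∀ u, ‖u‖ = 1 → 1 - 1 / 8 ≤ ‖inner ℂ v u‖ ^ 2 →
        3 * (M : ℝ) ≤ ε * θ * (‖adjMulVec g u‖ ^ 2 / 2 - L) := by
      intro u hu huv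
      have h1 := hcap u hu
      rw [hq u hu] at h1
      have hh0 : 0 ≤ h := by positivity
      -- On the cap `2 * ‖inner ℂ v u‖ ^ 2 - 1 ≥ 2 * (7 / 8) - 1 = 3 / 4`.
      have h2 : h * (3 / 4) ≤ ε * (‖adjMulVec g u‖ ^ 2 / 2 - L) := by
        refine le_trans ?_ h1
        exact mul_le_mul hg.le (by linarith) (by norm_num) (norm_nonneg _)
      have h3 := mul_le_mul_of_nonneg_left h2 hθ0
      linarith
    rcases hε with rfl | rfl
    · exact Or.inl ⟨v, hv, by simpa only [one_mul] using key⟩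
    · exact Or.inr ⟨v, hv, by simpa only [neg_mul, one_mul] using key⟩
  refine (measure_mono hsub).trans ((measure_union_le _ _).trans ?_)
  rw [two_mul, ENNReal.ofReal_add (Real.exp_pos _).le (Real.exp_pos _).le]
  exact add_le_add (stdGaussian_wishart_cap hM hθ2 hθL le_rfl)
    (stdGaussian_wishart_cap hM (by rwa [abs_neg]) (by rwa [neg_sq]) le_rfl)

/-- Norm of a Gaussian matrix, with entries of variance `2`, multiplied by a contraction. -/
lemma stdGaussian_norm_mul (hM : 0 < M) (hKM : K ≤ M) {S : Matrix (Fin K) (Fin L) ℂ}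
    (hS : ‖S‖ ≤ 1) :
    stdGaussian (EuclideanSpace ℂ (Fin M × Fin L))
      {g | 18 * (M : ℝ) < ‖S * (matOf g)ᴴ‖ ^ 2}
      ≤ ENNReal.ofReal (Real.exp (-(M : ℝ) / 2)) := by
  have hM' : (0 : ℝ) < M := by exact_mod_cast hM
  have hcont : Continuous (Matrix.toEuclideanLin S) :=
    (Matrix.toEuclideanLin S).continuous_of_finiteDimensional
  have hm : Measurable (Function.uncurry fun (g : EuclideanSpace ℂ (Fin M × Fin L)) u =>
      (1 / 2 : ℝ) / 2 * ‖Matrix.toEuclideanLin S (adjMulVec g u)‖ ^ 2) := by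
    have := measurable_adjMulVec (M := M) (L := L) measurable_fst measurable_snd
    exact (((hcont.measurable.comp this).norm).pow_const 2).const_mul _
  -- The exponential moment at `θ = 1 / 2` is at most `2 ^ K ≤ 2 ^ M`, and the threshold is `27 / 8
  -- = (1 / 4) * (3 / 4) * 18`.
  refine (measure_le_of_large_on_cap (ν := stdGaussian (EuclideanSpace ℂ (Fin M × Fin L))) hM
    hm (δ := 1 / 8) (C := 2 ^ M) (t := 27 / 8 * M) (by norm_num) (by norm_num)
    (by positivity) (fun u hu => ?_) (fun g hg => ?_)).trans ?_
  · have hmu : Measurable fun g : EuclideanSpace ℂ (Fin M × Fin L) => adjMulVec g u :=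
      measurable_adjMulVec measurable_id measurable_const
    have h1 : ∫⁻ g, ENNReal.ofReal (Real.exp
            ((1 / 2 : ℝ) / 2 * ‖Matrix.toEuclideanLin S (adjMulVec g u)‖ ^ 2))
          ∂(stdGaussian (EuclideanSpace ℂ (Fin M × Fin L)))
        = ∫⁻ x, ENNReal.ofReal (Real.exp ((1 / 2 : ℝ) / 2 * ‖Matrix.toEuclideanLin S x‖ ^ 2))
          ∂(stdGaussian (EuclideanSpace ℂ (Fin L))) := by
      rw [← map_adjMulVec hu, lintegral_map _ hmu]
      exact (((hcont.measurable.norm).pow_const 2).const_mul _).exp.ennreal_ofReal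
    rw [h1]
    refine (lintegral_exp_norm_sq_le_of_adjoint (S' := Matrix.toEuclideanLin Sᴴ)
      hcont.measurable (fun x k => ?_) (fun k => ?_) (by norm_num) (by norm_num)).trans ?_
    · rw [real_inner_eq_re, real_inner_eq_re, Matrix.toEuclideanLin_conjTranspose_eq_adjoint,
        LinearMap.adjoint_inner_right]
    · have := (LinearMap.toContinuousLinearMap (Matrix.toEuclideanLin Sᴴ)).le_opNorm k
      rw [norm_toContinuousLinearMap_toEuclideanLin, Matrix.l2_opNorm_conjTranspose] at this
      exact this.trans (mul_le_of_le_one_left (norm_nonneg _) hS)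
    · refine ENNReal.ofReal_le_ofReal ?_
      rw [Fintype.card_fin, show (1 - 1 / 2 : ℝ)⁻¹ = 2 by norm_num]
      exact pow_le_pow_right₀ (by norm_num) hKM
  · rw [Set.mem_ofPred_eq] at hg
    set F := S * (matOf g)ᴴ with hF
    obtain ⟨ε, hε, v, hv, hcap⟩ := exists_large_on_cap (by simpa using hM)
      (Matrix.isSymmetric_toEuclideanLin_iff.mpr (Matrix.isHermitian_conjTranspose_mul_self F))
    rw [norm_toContinuousLinearMap_toEuclideanLin, Matrix.l2_opNorm_conjTranspose_mul_self,
      ← sq] at hcap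
    simp_rw [re_inner_conjTranspose_mul_self] at hcap
    have hFu (u : EuclideanSpace ℂ (Fin M)) :
        Matrix.toEuclideanLin F u = Matrix.toEuclideanLin S (adjMulVec g u) := by
      rw [← toEuclideanLin_conjTranspose_matOf, hF]
      simp [Matrix.toLpLin_apply, Matrix.mulVec_mulVec]
    -- The form is nonnegative: for `ε = -1`, taking `u = v` would force `‖F‖ ^ 2 ≤ 0`.
    have hε1 : ε = 1 := by
      rcases hε with rfl | rfl
      · rfl
      · have := hcap v hv
        rw [inner_self_eq_norm_sq_to_K, hv] at this
        norm_num at this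
        nlinarith [sq_nonneg ‖Matrix.toEuclideanLin F v‖]
    refine ⟨v, hv, fun u hu huv => ?_⟩
    have := hcap u hu
    rw [hε1, one_mul, hFu] at this
    have h2 : 18 * (M : ℝ) * (3 / 4) ≤ ‖F‖ ^ 2 * (2 * ‖inner ℂ v u‖ ^ 2 - 1) :=
      mul_le_mul hg.le (by linarith) (by norm_num) (by positivity)
    linarith
  · refine ENNReal.ofReal_le_ofReal ?_
    calc 2 ^ M * Real.exp (-(27 / 8 * M)) * (1 / 8 : ℝ)⁻¹ ^ M
        = 16 ^ M * Real.exp (-(27 / 8 * M)) := by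
          rw [mul_right_comm, ← mul_pow]; norm_num
      _ ≤ Real.exp (23 / 8) ^ M * Real.exp (-(27 / 8 * M)) := by
          gcongr
          exact sixteen_le_exp
      _ = _ := by
        rw [← Real.exp_nat_mul, ← Real.exp_add]
        ring_nf

lemma complexGaussian_eq_map (σ : ℝ) :
    complexGaussian (σ ^ 2).toNNReal
      = (complexGaussian 2).map fun z => ((σ / √2 : ℝ) : ℂ) * z := by
  have hg : (gaussianReal 0 ((σ ^ 2).toNNReal / 2))
      = (gaussianReal 0 (2 / 2)).map ((σ / √2) * ·) := by
    rw [gaussianReal_map_const_mul, mul_zero]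
    congr 1
    ext
    simp [div_pow, Real.coe_toNNReal _ (sq_nonneg σ)]
  rw [complexGaussian, hg, Measure.map_prod_map _ _ (by fun_prop) (by fun_prop), complexGaussian,
    Measure.map_map measurable_complex_mk (by fun_prop),
    Measure.map_map (by fun_prop) measurable_complex_mk]
  congr 1
  ext x
  apply Complex.ext <;> simp [Complex.mul_re, Complex.mul_im]

variable {Ω : Type*} [MeasurableSpace Ω] {μ : Measure Ω} {σ : ℝ}

/-- A bound for the probability of an open event carries over from the standard Gaussian. -/
lemma IsGaussianNoise.measure_le {E : Ω → Matrix (Fin M) (Fin L) ℂ} (hE : IsGaussianNoise μ E σ)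
    {B : Set (Matrix (Fin M) (Fin L) ℂ)} (hB : IsOpen B) {c : ENNReal}
    (h : stdGaussian (EuclideanSpace ℂ (Fin M × Fin L))
      {g | ((σ / √2 : ℝ) : ℂ) • matOf g ∈ B} ≤ c) :
    μ {ω | E ω ∈ B} ≤ c := by
  have hcont : Continuous (matOf : (Fin M × Fin L → ℂ) → Matrix (Fin M) (Fin L) ℂ) :=
    continuous_matrix fun i j => continuous_apply (i, j)
  have hlaw := hE.indep.hasLaw_pi (fun q : Fin M × Fin L => hE.law q.1 q.2)
  set X : Ω → Fin M × Fin L → ℂ := fun ω q => E ω q.1 q.2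
  have hmB : MeasurableSet (matOf ⁻¹' B : Set (Fin M × Fin L → ℂ)) :=
    (hB.preimage hcont).measurableSet
  have h1 : {ω | E ω ∈ B} = X ⁻¹' (matOf ⁻¹' B) := rfl
  have hpi : (Measure.pi fun _ : Fin M × Fin L => complexGaussian (σ ^ 2).toNNReal)
      = (Measure.pi fun _ : Fin M × Fin L => complexGaussian 2).map
          (fun g q => ((σ / √2 : ℝ) : ℂ) * g q) := by
    rw [Measure.pi_map_pi (fun _ => by fun_prop), complexGaussian_eq_map]
  rw [h1, ← Measure.map_apply_of_aemeasurable hlaw.aemeasurable hmB, hlaw.map_eq, hpi,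
    Measure.map_apply (by fun_prop) hmB]
  refine le_trans (le_of_eq ?_) h
  have hmB' : MeasurableSet {g : EuclideanSpace ℂ (Fin M × Fin L) |
      ((σ / √2 : ℝ) : ℂ) • matOf g ∈ B} := by
    have : Continuous fun g : EuclideanSpace ℂ (Fin M × Fin L) =>
        ((σ / √2 : ℝ) : ℂ) • matOf (g : Fin M × Fin L → ℂ) := by
      refine continuous_matrix fun i j => ?_
      change Continuous fun g : EuclideanSpace ℂ (Fin M × Fin L) => ((σ / √2 : ℝ) : ℂ) * g (i, j)
      fun_prop
    exact (hB.preimage this).measurableSet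
  rw [← map_pi_complexGaussian_two, Measure.map_apply (by fun_prop) hmB']
  rfl

lemma sq_div_sqrt_two (σ : ℝ) : (σ / √2) ^ 2 = σ ^ 2 / 2 := by
  rw [div_pow, Real.sq_sqrt zero_le_two]

/-- Deviation of the sample covariance of white noise. -/
lemma IsGaussianNoise.wishart (hM : 0 < M) (hL : 0 < L) {E : Ω → Matrix (Fin M) (Fin L) ℂ}
    (hE : IsGaussianNoise μ E σ) :
    μ {ω | σ ^ 2 * (8 * max (√(M * L)) M) < ‖E ω * (E ω)ᴴ - ((σ ^ 2 * L : ℝ) : ℂ) • 1‖}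
      ≤ ENNReal.ofReal (2 * Real.exp (-(M : ℝ) / 2)) := by
  refine hE.measure_le (B := {A | σ ^ 2 * (8 * max (√(M * L)) M)
    < ‖A * Aᴴ - ((σ ^ 2 * L : ℝ) : ℂ) • 1‖}) (isOpen_lt continuous_const (by fun_prop)) ?_
  refine (measure_mono fun g hg => ?_).trans (stdGaussian_wishart hM hL)
  rw [Set.mem_ofPred_eq, Set.mem_ofPred_eq] at hg
  rw [Set.mem_ofPred_eq]
  have h1 : (((σ / √2 : ℝ) : ℂ) • matOf g) * (((σ / √2 : ℝ) : ℂ) • matOf g)ᴴ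
        - ((σ ^ 2 * L : ℝ) : ℂ) • 1
      = ((σ ^ 2 : ℝ) : ℂ) • ((1 / 2 : ℂ) • (matOf g * (matOf g)ᴴ) - (L : ℂ) • 1) := by
    rw [Matrix.conjTranspose_smul, Matrix.smul_mul, Matrix.mul_smul, smul_smul, smul_sub,
      smul_smul, smul_smul]
    congr 2
    · rw [show star (((σ / √2 : ℝ) : ℂ)) = ((σ / √2 : ℝ) : ℂ) from Complex.conj_ofReal _,
        ← Complex.ofReal_mul, ← sq, sq_div_sqrt_two]
      push_cast
      ring
    · push_cast
      ring
  rw [h1, norm_smul, Complex.norm_real, Real.norm_of_nonneg (sq_nonneg σ)] at hg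
  exact lt_of_mul_lt_mul_left hg (sq_nonneg σ)

/-- Norm of a fixed matrix times white noise. -/
lemma IsGaussianNoise.norm_mul (hM : 0 < M) (hKM : K ≤ M) {E : Ω → Matrix (Fin M) (Fin L) ℂ}
    (hE : IsGaussianNoise μ E σ) (hσ : 0 ≤ σ) (S : Matrix (Fin K) (Fin L) ℂ) :
    μ {ω | 3 * √M * σ * ‖S‖ < ‖S * (E ω)ᴴ‖} ≤ ENNReal.ofReal (Real.exp (-(M : ℝ) / 2)) := by
  refine hE.measure_le (B := {A | 3 * √M * σ * ‖S‖ < ‖S * Aᴴ‖})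
    (isOpen_lt continuous_const (by fun_prop)) ?_
  have hS1 : ‖((‖S‖⁻¹ : ℝ) : ℂ) • S‖ ≤ 1 := by
    rw [norm_smul, Complex.norm_real, norm_inv, norm_norm]
    exact inv_mul_le_one
  refine (measure_mono fun g hg => ?_).trans (stdGaussian_norm_mul hM hKM hS1)
  rw [Set.mem_ofPred_eq, Set.mem_ofPred_eq, Matrix.conjTranspose_smul, Matrix.mul_smul, norm_smul,
    norm_star, Complex.norm_real, Real.norm_of_nonneg (by positivity)] at hg
  rw [Set.mem_ofPred_eq, Matrix.smul_mul, norm_smul, Complex.norm_real, norm_inv, norm_norm]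
  -- The strict inequality in `hg` excludes `S = 0`, where normalising by `‖S‖⁻¹` carries no
  -- information.
  have hS0 : 0 < ‖S‖ := by
    rcases (norm_nonneg S).eq_or_lt with h | h
    · rw [norm_eq_zero.mp h.symm] at hg
      simp at hg
    · exact h
  have h2 : 3 * √M * √2 * ‖S‖ < ‖S * (matOf g)ᴴ‖ := by
    have hs2 : (0 : ℝ) < √2 := by positivity
    have : σ / √2 * (3 * √M * √2 * ‖S‖) < σ / √2 * ‖S * (matOf g)ᴴ‖ := by
      refine lt_of_eq_of_lt ?_ hg
      field_simp
    exact lt_of_mul_lt_mul_left this (by positivity)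
  have h3 : 3 * √M * √2 < ‖S‖⁻¹ * ‖S * (matOf g)ᴴ‖ := by
    rw [inv_mul_eq_div, lt_div_iff₀ hS0]
    exact h2
  have h4 := pow_lt_pow_left₀ h3 (by positivity) two_ne_zero
  rw [mul_pow, mul_pow, Real.sq_sqrt (by positivity), Real.sq_sqrt (by positivity)] at h4
  linarith

end RandomMatrix

/-! ### Quadratic forms, singular values and canonical angles. -/

section LinearAlgebra

variable {m n p : ℕ}

lemma toEuclideanLin_mul_apply (A : Matrix (Fin m) (Fin n) ℂ) (B : Matrix (Fin n) (Fin p) ℂ)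
    (x : EuclideanSpace ℂ (Fin p)) :
    Matrix.toEuclideanLin (A * B) x = Matrix.toEuclideanLin A (Matrix.toEuclideanLin B x) := by
  simp [Matrix.toLpLin_apply, Matrix.mulVec_mulVec]

lemma toEuclideanLin_one_apply (x : EuclideanSpace ℂ (Fin n)) :
    Matrix.toEuclideanLin (1 : Matrix (Fin n) (Fin n) ℂ) x = x := by
  ext; simp

lemma norm_toEuclideanLin_apply_le (A : Matrix (Fin m) (Fin n) ℂ)
    (x : EuclideanSpace ℂ (Fin n)) : ‖Matrix.toEuclideanLin A x‖ ≤ ‖A‖ * ‖x‖ :=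
  (LinearMap.toContinuousLinearMap (Matrix.toEuclideanLin A)).le_opNorm x

lemma inner_toEuclideanLin_right (A : Matrix (Fin m) (Fin n) ℂ) (x : EuclideanSpace ℂ (Fin m))
    (y : EuclideanSpace ℂ (Fin n)) :
    inner ℂ x (Matrix.toEuclideanLin A y) = inner ℂ (Matrix.toEuclideanLin Aᴴ x) y := by
  rw [Matrix.toEuclideanLin_conjTranspose_eq_adjoint, LinearMap.adjoint_inner_left]

lemma norm_toEuclideanLin_of_isometry {A : Matrix (Fin m) (Fin n) ℂ} (hA : Aᴴ * A = 1)
    (x : EuclideanSpace ℂ (Fin n)) : ‖Matrix.toEuclideanLin A x‖ = ‖x‖ := by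
  rw [← sq_eq_sq₀ (norm_nonneg _) (norm_nonneg _), ← re_inner_conjTranspose_mul_self, hA,
    toEuclideanLin_one_apply, inner_self_eq_norm_sq_to_K]
  norm_cast

lemma norm_le_of_forall_toEuclideanLin {A : Matrix (Fin m) (Fin n) ℂ} {c : ℝ} (hc : 0 ≤ c)
    (h : ∀ x, ‖Matrix.toEuclideanLin A x‖ ≤ c * ‖x‖) : ‖A‖ ≤ c := by
  rw [← norm_toContinuousLinearMap_toEuclideanLin]
  exact ContinuousLinearMap.opNorm_le_bound _ hc h

lemma norm_le_one_of_isometry {A : Matrix (Fin m) (Fin n) ℂ} (hA : Aᴴ * A = 1) : ‖A‖ ≤ 1 :=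
  norm_le_of_forall_toEuclideanLin zero_le_one fun x => by
    rw [norm_toEuclideanLin_of_isometry hA, one_mul]

lemma re_inner_le_norm_mul (A : Matrix (Fin n) (Fin n) ℂ) (x : EuclideanSpace ℂ (Fin n)) :
    |(inner ℂ x (Matrix.toEuclideanLin A x)).re| ≤ ‖A‖ * ‖x‖ ^ 2 := by
  refine (Complex.abs_re_le_norm _).trans ((norm_inner_le_norm _ _).trans ?_)
  have := norm_toEuclideanLin_apply_le A x
  nlinarith [norm_nonneg x]

lemma re_inner_diagonal (d : Fin n → ℝ) (x : EuclideanSpace ℂ (Fin n)) :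
    (inner ℂ x (Matrix.toEuclideanLin (Matrix.diagonal fun j => (d j : ℂ)) x)).re
      = ∑ j, d j * ‖x j‖ ^ 2 := by
  rw [PiLp.inner_apply, Complex.re_sum]
  refine Finset.sum_congr rfl fun j _ => ?_
  simp only [Matrix.toLpLin_apply, Matrix.mulVec_diagonal, RCLike.inner_apply]
  rw [mul_assoc, Complex.mul_conj, Complex.normSq_eq_norm_sq, ← Complex.ofReal_mul,
    Complex.ofReal_re]

lemma mul_norm_sq_le_re_inner_of_le_eigenvalues {V : Type*} [NormedAddCommGroup V]
    [InnerProductSpace ℂ V] [FiniteDimensional ℂ V] {T : V →ₗ[ℂ] V} (hT : T.IsSymmetric)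
    (hn : Module.finrank ℂ V = n) {c : ℝ} (hc : ∀ i, c ≤ hT.eigenvalues hn i) (x : V) :
    c * ‖x‖ ^ 2 ≤ (inner ℂ x (T x)).re := by
  set b := hT.eigenvectorBasis hn
  have hTb (i) : inner ℂ (b i) (T x) = hT.eigenvalues hn i * inner ℂ (b i) x := by
    rw [← hT, hT.apply_eigenvectorBasis, inner_smul_left]
    simp [b]
  rw [← b.sum_inner_mul_inner x (T x), Complex.re_sum, ← b.sum_sq_norm_inner_right x,
    Finset.mul_sum]
  refine Finset.sum_le_sum fun j _ => ?_
  rw [hTb, mul_left_comm, ← inner_conj_symm x (b j), ← Complex.normSq_eq_conj_mul_self,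
    Complex.normSq_eq_norm_sq, ← Complex.ofReal_mul, Complex.ofReal_re]
  exact mul_le_mul_of_nonneg_right (hc j) (sq_nonneg _)

lemma eigDesc_last_mul_le {A : Matrix (Fin n) (Fin n) ℂ} (hA : A.IsHermitian) (hn : n - 1 < n)
    (x : EuclideanSpace ℂ (Fin n)) :
    eigDesc hA ⟨n - 1, hn⟩ * ‖x‖ ^ 2 ≤ (inner ℂ x (Matrix.toEuclideanLin A x)).re := by
  refine mul_norm_sq_le_re_inner_of_le_eigenvalues
    (Matrix.isSymmetric_toEuclideanLin_iff.mpr hA) finrank_euclideanSpace (fun i => ?_) x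
  refine hA.eigenvalues₀_antitone (Fin.le_def.mpr ?_)
  have := i.isLt
  simp only [Fintype.card_fin] at this
  simp only [Fin.val_cast]
  omega

lemma eigDesc_pos {A : Matrix (Fin n) (Fin n) ℂ} (hA : A.PosDef) (j : Fin n) :
    0 < eigDesc hA.isHermitian j := by
  have := hA.eigenvalues_pos ((Fintype.equivOfCardEq (Fintype.card_fin _))
    (Fin.cast (Fintype.card_fin n).symm j))
  simpa [Matrix.IsHermitian.eigenvalues, eigDesc] using this

lemma sv_last_mul_le (A : Matrix (Fin m) (Fin n) ℂ) (x : EuclideanSpace ℂ (Fin n)) :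
    sv A n * ‖x‖ ≤ ‖Matrix.toEuclideanLin A x‖ := by
  rcases Nat.eq_zero_or_pos n with rfl | hn
  · simp [Subsingleton.elim x 0]
  set T := Matrix.toEuclideanLin A
  have h := mul_norm_sq_le_re_inner_of_le_eigenvalues T.isSymmetric_adjoint_comp_self
    (finrank_euclideanSpace_fin (𝕜 := ℂ) (n := n)) (c := sv A n ^ 2) (fun i => ?_) x
  · rw [LinearMap.comp_apply, LinearMap.adjoint_inner_right, inner_self_eq_norm_sq_to_K] at h
    refine le_of_sq_le_sq ?_ (norm_nonneg _)
    rw [mul_pow]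
    exact h.trans (le_of_eq (by norm_cast))
  · rw [sv, T.sq_singularValues_of_lt finrank_euclideanSpace_fin (by omega : n - 1 < n)]
    refine T.isSymmetric_adjoint_comp_self.eigenvalues_antitone _ (Fin.le_def.mpr ?_)
    have := i.isLt
    simp only
    omega

lemma sv_last_pos {A : Matrix (Fin m) (Fin n) ℂ} (hn : 0 < n)
    (hA : Function.Injective (Matrix.toEuclideanLin A)) : 0 < sv A n :=
  (LinearMap.injective_iff_forall_lt_finrank_singularValues_pos _).mp hA _ (by simp; omega)

/-- Each singular value is attained: `A` stretches a suitable eigenvector of `AᴴA` by exactly that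
factor. -/
lemma le_sv {A : Matrix (Fin m) (Fin n) ℂ} {c : ℝ}
    (h : ∀ x, c * ‖x‖ ≤ ‖Matrix.toEuclideanLin A x‖) (j : Fin n) : c ≤ sv A (j + 1) := by
  set T := Matrix.toEuclideanLin A
  obtain ⟨v, hv⟩ := (T.hasEigenvalue_adjoint_comp_self_sq_singularValues (n := j)
    (by simp)).exists_hasEigenvector
  have h1 : ‖T v‖ ^ 2 = T.singularValues j ^ 2 * ‖v‖ ^ 2 := by
    have h2 : inner ℂ v ((LinearMap.adjoint T ∘ₗ T) v)
        = ((T.singularValues j : ℂ) ^ 2) * ((‖v‖ : ℂ) ^ 2) := by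
      rw [hv.apply_eq_smul, inner_smul_right, inner_self_eq_norm_sq_to_K]
      norm_cast
    rw [LinearMap.comp_apply, LinearMap.adjoint_inner_right, inner_self_eq_norm_sq_to_K] at h2
    refine Complex.ofReal_injective ?_
    push_cast
    exact h2
  have hv0 : 0 < ‖v‖ := norm_pos_iff.mpr hv.2
  have h2 : ‖T v‖ = T.singularValues j * ‖v‖ := by
    rw [← sq_eq_sq₀ (norm_nonneg _) (mul_nonneg (T.singularValues_nonneg _) hv0.le), h1, mul_pow]
  have h3 := h v
  change c * ‖v‖ ≤ ‖T v‖ at h3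
  rw [h2] at h3
  simpa [sv] using le_of_mul_le_mul_right h3 hv0

/-- A square matrix is bounded below as soon as its adjoint is. -/
lemma mul_norm_le_of_conjTranspose {A : Matrix (Fin n) (Fin n) ℂ} {c : ℝ} (hc : 0 < c)
    (h : ∀ x, c * ‖x‖ ≤ ‖Matrix.toEuclideanLin Aᴴ x‖) (x : EuclideanSpace ℂ (Fin n)) :
    c * ‖x‖ ≤ ‖Matrix.toEuclideanLin A x‖ := by
  have hinj : Function.Injective (Matrix.toEuclideanLin Aᴴ) := by
    rw [← LinearMap.ker_eq_bot, LinearMap.ker_eq_bot']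
    intro y hy
    have := h y
    rw [hy, norm_zero] at this
    exact norm_le_zero_iff.mp (nonpos_of_mul_nonpos_right this hc)
  -- An injective square matrix is surjective, so `x = Aᴴ w`. Cauchy-Schwarz for `‖x‖² = ⟨w, A x⟩`,
  -- together with `c * ‖w‖ ≤ ‖x‖`, gives the claim.
  obtain ⟨w, rfl⟩ := LinearMap.surjective_of_injective hinj x
  set y := Matrix.toEuclideanLin Aᴴ w with hy
  rcases (norm_nonneg y).eq_or_lt with h0 | h0
  · rw [← h0, mul_zero]; exact norm_nonneg _
  have h1 : ‖y‖ ^ 2 ≤ ‖w‖ * ‖Matrix.toEuclideanLin A y‖ := by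
    have h2 := norm_inner_le_norm (𝕜 := ℂ) w (Matrix.toEuclideanLin A y)
    rw [inner_toEuclideanLin_right, ← hy, inner_self_eq_norm_sq_to_K] at h2
    simpa using h2
  have h3 := h w
  rw [← hy] at h3
  have h4 := mul_le_mul_of_nonneg_right h3 (norm_nonneg (Matrix.toEuclideanLin A y))
  have h5 : c * ‖y‖ ^ 2 ≤ ‖y‖ * ‖Matrix.toEuclideanLin A y‖ := by nlinarith
  refine le_of_mul_le_mul_left ?_ h0
  linarith

lemma subspaceDist_le {M K : ℕ} {Uhat U : Matrix (Fin M) (Fin K) ℂ} {c ε : ℝ} (hε : 0 ≤ ε)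
    (hc : 0 ≤ c) (hcε : 1 - c ^ 2 ≤ ε ^ 2)
    (h : ∀ x, c * ‖x‖ ≤ ‖Matrix.toEuclideanLin (Uhatᴴ * U) x‖) : subspaceDist Uhat U ≤ ε := by
  rw [subspaceDist, Matrix.l2_opNorm_diagonal, pi_norm_le_iff_of_nonneg hε]
  intro j
  rw [Complex.norm_real, canonicalAngle, Real.sin_arccos, Real.norm_of_nonneg (Real.sqrt_nonneg _)]
  refine Real.sqrt_le_iff.mpr ⟨hε, ?_⟩
  have := le_sv h j
  nlinarith

end LinearAlgebra

/-! ### Weyl and Davis-Kahan perturbation bounds. -/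

section DavisKahan

variable {K n : ℕ}

/-- The first `K` columns. -/
abbrev headCols (V : Matrix (Fin (K + n)) (Fin (K + n)) ℂ) : Matrix (Fin (K + n)) (Fin K) ℂ :=
  V.submatrix id (Fin.castAdd n)

/-- The columns after the first `K`. -/
abbrev tailCols (V : Matrix (Fin (K + n)) (Fin (K + n)) ℂ) : Matrix (Fin (K + n)) (Fin n) ℂ :=
  V.submatrix id (Fin.natAdd K)

lemma submatrix_isometry {m k : ℕ} {V : Matrix (Fin m) (Fin m) ℂ}
    (hV : V ∈ Matrix.unitaryGroup (Fin m) ℂ) {e : Fin k → Fin m} (he : Function.Injective e) :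
    (V.submatrix id e)ᴴ * V.submatrix id e = 1 := by
  have h : (V.submatrix id e)ᴴ * V.submatrix id e = (Vᴴ * V).submatrix e e := by
    ext i j; simp [Matrix.mul_apply]
  rw [h, ← Matrix.star_eq_conjTranspose, Matrix.mem_unitaryGroup_iff'.mp hV,
    Matrix.submatrix_one e he]

lemma head_add_tail {V : Matrix (Fin (K + n)) (Fin (K + n)) ℂ}
    (hV : V ∈ Matrix.unitaryGroup (Fin (K + n)) ℂ) :
    headCols V * (headCols V)ᴴ + tailCols V * (tailCols V)ᴴ = 1 := by
  rw [← Matrix.mem_unitaryGroup_iff.mp hV, Matrix.star_eq_conjTranspose]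
  ext i j
  simp [Matrix.mul_apply, Fin.sum_univ_add]

lemma mul_submatrix_of_diagonalization {m k : ℕ} {V R : Matrix (Fin m) (Fin m) ℂ}
    (hV : V ∈ Matrix.unitaryGroup (Fin m) ℂ) {lam : Fin m → ℝ}
    (hR : R = V * Matrix.diagonal (fun j => (lam j : ℂ)) * Vᴴ) (e : Fin k → Fin m) :
    R * V.submatrix id e = V.submatrix id e * Matrix.diagonal (fun j => (lam (e j) : ℂ)) := by
  have h : R * V = V * Matrix.diagonal (fun j => (lam j : ℂ)) := by
    rw [hR, Matrix.mul_assoc, ← Matrix.star_eq_conjTranspose, Matrix.mem_unitaryGroup_iff'.mp hV,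
      Matrix.mul_one]
  ext i j
  have := congrFun (congrFun h i) (e j)
  rw [Matrix.mul_diagonal] at this ⊢
  simpa [Matrix.mul_apply] using this

/-- Weyl's inequality for the first `K` eigenvalues. -/
lemma le_eigenvalue_of_perturbation (hK : 0 < K)
    {R R' Δ V V' : Matrix (Fin (K + n)) (Fin (K + n)) ℂ}
    (hV : V ∈ Matrix.unitaryGroup (Fin (K + n)) ℂ) (hV' : V' ∈ Matrix.unitaryGroup (Fin (K + n)) ℂ)
    {lam lam' : Fin (K + n) → ℝ} (hlam' : Antitone lam')
    (hR : R = V * Matrix.diagonal (fun j => (lam j : ℂ)) * Vᴴ)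
    (hR' : R' = V' * Matrix.diagonal (fun j => (lam' j : ℂ)) * V'ᴴ)
    {s g η : ℝ} (hRR' : R' = R + (s : ℂ) • 1 + Δ) (hΔ : ‖Δ‖ ≤ η)
    (hg : ∀ j : Fin K, g ≤ lam (Fin.castAdd n j)) (j : Fin K) :
    g + s - η ≤ lam' (Fin.castAdd n j) := by
  set U := headCols V with hU
  have hUU : Uᴴ * U = 1 := submatrix_isometry hV (Fin.castAdd_injective K n)
  -- `W` has only `K - 1` rows, so some nonzero `U x` is orthogonal to the first `K - 1`
  -- eigenvectors of `R'`. Its Rayleigh quotient is at most the `K`-th eigenvalue of `R'`, hence at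
  -- most each of the first `K`.
  let W : Matrix (Fin (K - 1)) (Fin K) ℂ :=
    (V'.submatrix id (fun i : Fin (K - 1) => Fin.castAdd n ⟨i, by omega⟩))ᴴ * U
  obtain ⟨x, hx0, hx⟩ : ∃ x ≠ 0, Matrix.toEuclideanLin W x = 0 := by
    have : LinearMap.ker (Matrix.toEuclideanLin W) ≠ ⊥ :=
      LinearMap.ker_ne_bot_of_finrank_lt (by simp; omega)
    obtain ⟨x, hx, hx0⟩ := Submodule.exists_mem_ne_zero_of_ne_bot this
    exact ⟨x, hx0, hx⟩
  set y := Matrix.toEuclideanLin U x with hy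
  have hyn : ‖y‖ = ‖x‖ := norm_toEuclideanLin_of_isometry hUU x
  set z := Matrix.toEuclideanLin V'ᴴ y with hz
  have hzn : ‖z‖ = ‖x‖ := by
    rw [hz, norm_toEuclideanLin_of_isometry, hyn]
    rw [Matrix.conjTranspose_conjTranspose]
    exact Matrix.mem_unitaryGroup_iff.mp hV'
  have hz0 : ∀ i : Fin (K + n), (i : ℕ) < K - 1 → z i = 0 := by
    intro i hi
    have h1 := congrArg (fun w : EuclideanSpace ℂ (Fin (K - 1)) => w ⟨i, hi⟩) hx
    rw [toEuclideanLin_mul_apply, ← hy] at h1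
    simpa [hz, Matrix.toLpLin_apply, Matrix.mulVec, dotProduct] using h1
  have hup : (inner ℂ y (Matrix.toEuclideanLin R' y)).re ≤ lam' (Fin.castAdd n j) * ‖x‖ ^ 2 := by
    rw [hR', Matrix.mul_assoc, toEuclideanLin_mul_apply, inner_toEuclideanLin_right,
      toEuclideanLin_mul_apply, ← hz, re_inner_diagonal, ← hzn, EuclideanSpace.norm_sq_eq,
      Finset.mul_sum]
    refine Finset.sum_le_sum fun i _ => ?_
    rcases lt_or_ge (i : ℕ) (K - 1) with hi | hi
    · simp [hz0 i hi]
    · refine mul_le_mul_of_nonneg_right (hlam' (Fin.le_def.mpr ?_)) (sq_nonneg _)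
      have := j.isLt
      simp only [Fin.val_castAdd]
      omega
  have hlow : (g + s - η) * ‖x‖ ^ 2 ≤ (inner ℂ y (Matrix.toEuclideanLin R' y)).re := by
    have h1 : g * ‖x‖ ^ 2 ≤ (inner ℂ y (Matrix.toEuclideanLin R y)).re := by
      rw [hy, ← toEuclideanLin_mul_apply, hU,
        mul_submatrix_of_diagonalization hV hR (Fin.castAdd n), ← hU, toEuclideanLin_mul_apply,
        inner_toEuclideanLin_right, ← toEuclideanLin_mul_apply, hUU, toEuclideanLin_one_apply,
        re_inner_diagonal, EuclideanSpace.norm_sq_eq, Finset.mul_sum]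
      exact Finset.sum_le_sum fun i _ => mul_le_mul_of_nonneg_right (hg i) (sq_nonneg _)
    have h2 := (abs_le.mp (re_inner_le_norm_mul Δ y)).1
    rw [hyn] at h2
    have h3 : ‖Δ‖ * ‖x‖ ^ 2 ≤ η * ‖x‖ ^ 2 := by gcongr
    rw [hRR', map_add, map_add, LinearMap.add_apply, LinearMap.add_apply, inner_add_right,
      inner_add_right, map_smul, LinearMap.smul_apply, inner_smul_right, toEuclideanLin_one_apply,
      inner_self_eq_norm_sq_to_K, hyn, Complex.add_re, Complex.add_re]
    have h4 : ((s : ℂ) * ((‖x‖ : ℝ) : ℂ) ^ 2).re = s * ‖x‖ ^ 2 := by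
      norm_cast
    erw [h4]
    linarith
  exact le_of_mul_le_mul_right (hlow.trans hup) (by positivity)

/-- The Davis-Kahan theorem for the leading eigenvectors of a matrix of rank `K`. -/
lemma norm_tail_mul_head_le (hK : 0 < K)
    {R R' Δ V V' : Matrix (Fin (K + n)) (Fin (K + n)) ℂ}
    (hV : V ∈ Matrix.unitaryGroup (Fin (K + n)) ℂ) (hV' : V' ∈ Matrix.unitaryGroup (Fin (K + n)) ℂ)
    {lam lam' : Fin (K + n) → ℝ} (hlam' : Antitone lam')
    (hR : R = V * Matrix.diagonal (fun j => (lam j : ℂ)) * Vᴴ)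
    (hR' : R' = V' * Matrix.diagonal (fun j => (lam' j : ℂ)) * V'ᴴ)
    {s g η : ℝ} (hRR' : R' = R + (s : ℂ) • 1 + Δ) (hΔ : ‖Δ‖ ≤ η) (hηg : η < g)
    (hg : ∀ j : Fin K, g ≤ lam (Fin.castAdd n j)) (h0 : ∀ i : Fin n, lam (Fin.natAdd K i) = 0) :
    ‖(tailCols V)ᴴ * headCols V'‖ ≤ η / (g - η) := by
  have hη : 0 ≤ η := (norm_nonneg _).trans hΔ
  have hgη : 0 < g - η := by linarith
  have hweyl := le_eigenvalue_of_perturbation hK hV hV' hlam' hR hR' hRR' hΔ hg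
  set T := tailCols V with hT
  set H := headCols V' with hH
  set d : Fin K → ℂ := fun j => ((lam' (Fin.castAdd n j) - s : ℝ) : ℂ) with hd
  have hTiso : Tᴴ * T = 1 := submatrix_isometry hV (Fin.natAdd_injective n K)
  have hHiso : Hᴴ * H = 1 := submatrix_isometry hV' (Fin.castAdd_injective K n)
  have hTR : Tᴴ * R = 0 := by
    have h1 : R * T = 0 := by
      rw [hT, mul_submatrix_of_diagonalization hV hR (Fin.natAdd K)]
      simp [h0]
    have h2 : Rᴴ = R := by
      rw [hR, Matrix.conjTranspose_mul, Matrix.conjTranspose_mul, Matrix.diagonal_conjTranspose,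
        Matrix.conjTranspose_conjTranspose, Matrix.mul_assoc]
      congr 3
      ext j
      simp
    rw [← h2, ← Matrix.conjTranspose_mul, h1, Matrix.conjTranspose_zero]
  -- Evaluate `Tᴴ R' H` in two ways. As `Tᴴ R = 0`, the Sylvester equation degenerates to right
  -- multiplication by the diagonal of shifted eigenvalues, whose entries are at least `g - η`.
  have hsyl : Tᴴ * H * Matrix.diagonal d = Tᴴ * Δ * H := by
    have h1 : R' * H = H * Matrix.diagonal (fun j => (lam' (Fin.castAdd n j) : ℂ)) :=
      mul_submatrix_of_diagonalization hV' hR' (Fin.castAdd n)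
    have h2 : Matrix.diagonal d = Matrix.diagonal (fun j => (lam' (Fin.castAdd n j) : ℂ))
        - (s : ℂ) • 1 := by
      ext i j
      rcases eq_or_ne i j with rfl | h
      · simp [hd]
      · simp [h]
    have h3 : Δ = R' - R - (s : ℂ) • 1 := by rw [hRR']; abel
    rw [h2, Matrix.mul_sub, Matrix.mul_assoc, ← h1, h3, Matrix.mul_sub, Matrix.mul_sub, hTR,
      Matrix.sub_mul, Matrix.sub_mul]
    simp [Matrix.mul_assoc]
  have hd0 : ∀ j, g - η ≤ ‖d j‖ := fun j => by
    rw [hd, Complex.norm_real]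
    exact le_trans (by linarith [hweyl j]) (le_abs_self _)
  have hX : Tᴴ * H = Tᴴ * Δ * H * Matrix.diagonal (fun j => (d j)⁻¹) := by
    have : Matrix.diagonal d * Matrix.diagonal (fun j => (d j)⁻¹) = 1 := by
      rw [Matrix.diagonal_mul_diagonal, ← Matrix.diagonal_one]
      congr 1
      ext j
      exact mul_inv_cancel₀ (norm_pos_iff.mp (hgη.trans_le (hd0 j)))
    rw [← hsyl, Matrix.mul_assoc (Tᴴ * H), this, Matrix.mul_one]
  have hinv : ‖Matrix.diagonal (fun j => (d j)⁻¹)‖ ≤ (g - η)⁻¹ := by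
    rw [Matrix.l2_opNorm_diagonal, pi_norm_le_iff_of_nonneg (inv_nonneg.mpr hgη.le)]
    intro j
    rw [norm_inv]
    exact inv_anti₀ hgη (hd0 j)
  have hTn : ‖Tᴴ‖ ≤ 1 := by
    rw [Matrix.l2_opNorm_conjTranspose]; exact norm_le_one_of_isometry hTiso
  rw [hX, div_eq_mul_inv]
  refine (Matrix.l2_opNorm_mul _ _).trans (mul_le_mul ?_ hinv (norm_nonneg _) hη)
  calc ‖Tᴴ * Δ * H‖ ≤ ‖Tᴴ‖ * ‖Δ‖ * ‖H‖ :=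
        (Matrix.l2_opNorm_mul _ _).trans
          (mul_le_mul_of_nonneg_right (Matrix.l2_opNorm_mul _ _) (norm_nonneg _))
    _ ≤ 1 * η * 1 := by
        gcongr
        exact norm_le_one_of_isometry hHiso
    _ = η := by ring

/-- Pythagoras for the columns of `V` gives `‖UᴴH x‖² ≥ (1 - ε²)‖x‖²`. Since `ε < 1` this bound is
positive, so it passes to the adjoint `HᴴU` that defines the angles. -/
lemma subspaceDist_head_le {V V' : Matrix (Fin (K + n)) (Fin (K + n)) ℂ}
    (hV : V ∈ Matrix.unitaryGroup (Fin (K + n)) ℂ) (hV' : V' ∈ Matrix.unitaryGroup (Fin (K + n)) ℂ)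
    {ε : ℝ} (hε : ‖(tailCols V)ᴴ * headCols V'‖ ≤ ε) (hε1 : ε < 1) :
    subspaceDist (headCols V') (headCols V) ≤ ε := by
  have hε0 : 0 ≤ ε := (norm_nonneg _).trans hε
  have hpos : 0 < 1 - ε ^ 2 := by nlinarith
  have hsq : √(1 - ε ^ 2) ^ 2 = 1 - ε ^ 2 := Real.sq_sqrt hpos.le
  refine subspaceDist_le (c := √(1 - ε ^ 2)) hε0 (Real.sqrt_nonneg _) (by linarith)
    (mul_norm_le_of_conjTranspose (Real.sqrt_pos.mpr hpos) fun x => ?_)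
  rw [Matrix.conjTranspose_mul, Matrix.conjTranspose_conjTranspose]
  refine le_of_sq_le_sq ?_ (norm_nonneg _)
  rw [mul_pow, hsq]
  set T := tailCols V
  set U := headCols V
  set H := headCols V'
  have h1 : ‖x‖ ^ 2 = ‖Matrix.toEuclideanLin (Uᴴ * H) x‖ ^ 2
      + ‖Matrix.toEuclideanLin (Tᴴ * H) x‖ ^ 2 := by
    rw [← re_inner_conjTranspose_mul_self, ← re_inner_conjTranspose_mul_self, ← Complex.add_re,
      ← inner_add_right, ← LinearMap.add_apply, ← map_add]
    have : (Uᴴ * H)ᴴ * (Uᴴ * H) + (Tᴴ * H)ᴴ * (Tᴴ * H) = 1 := by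
      calc _ = Hᴴ * (U * Uᴴ + T * Tᴴ) * H := by
            simp only [Matrix.conjTranspose_mul, Matrix.conjTranspose_conjTranspose,
              Matrix.mul_add, Matrix.add_mul, Matrix.mul_assoc]
        _ = 1 := by
            rw [head_add_tail hV, Matrix.mul_one]
            exact submatrix_isometry hV' (Fin.castAdd_injective K n)
    rw [this, toEuclideanLin_one_apply, inner_self_eq_norm_sq_to_K]
    norm_cast
  have h2 : ‖Matrix.toEuclideanLin (Tᴴ * H) x‖ ^ 2 ≤ ε ^ 2 * ‖x‖ ^ 2 := by
    rw [← mul_pow]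
    exact pow_le_pow_left₀ (norm_nonneg _) ((norm_toEuclideanLin_apply_le _ _).trans
      (mul_le_mul_of_nonneg_right hε (norm_nonneg _))) 2
  linarith

end DavisKahan

/-! ### Spectrum and range of the noiseless covariance. -/

section Signal

variable {K n : ℕ}

lemma rank_eq_of_injective {m k : ℕ} {A : Matrix (Fin m) (Fin k) ℂ}
    (hA : Function.Injective A.mulVec) : A.rank = k := by
  rw [Matrix.rank, LinearMap.finrank_range_of_inj hA]
  simp

/-- Compressing by `Aᴴ` and `A` yields a product of the invertible matrices `AᴴA`, `C`, `AᴴA`, and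
compression cannot raise the rank. -/
lemma rank_mul_posDef_mul_conjTranspose {m k : ℕ} {A : Matrix (Fin m) (Fin k) ℂ}
    (hA : Function.Injective A.mulVec) {C : Matrix (Fin k) (Fin k) ℂ} (hC : C.PosDef) :
    (A * C * Aᴴ).rank = k := by
  have hAA := (Matrix.PosDef.conjTranspose_mul_self A hA).isUnit
  refine le_antisymm ?_ ?_
  · calc _ ≤ (A * C).rank := Matrix.rank_mul_le_left _ _
      _ ≤ A.rank := Matrix.rank_mul_le_left _ _
      _ = k := rank_eq_of_injective hA
  · have h : (Aᴴ * (A * C * Aᴴ) * A).rank = k := by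
      rw [show Aᴴ * (A * C * Aᴴ) * A = Aᴴ * A * C * (Aᴴ * A) by simp only [Matrix.mul_assoc],
        Matrix.rank_of_isUnit _ ((hAA.mul hC.isUnit).mul hAA), Fintype.card_fin]
    calc k = _ := h.symm
      _ ≤ (Aᴴ * (A * C * Aᴴ)).rank := Matrix.rank_mul_le_left _ _
      _ ≤ _ := Matrix.rank_mul_le_right _ _

lemma ne_zero_iff_of_card {M k : ℕ} {lam : Fin M → ℝ} (hlam : Antitone lam) (h0 : ∀ i, 0 ≤ lam i)
    (hcard : Fintype.card {i // (lam i : ℂ) ≠ 0} = k) (i : Fin M) : lam i ≠ 0 ↔ (i : ℕ) < k := by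
  have hcard' : (Finset.univ.filter fun i => lam i ≠ 0).card = k := by
    rw [← hcard, Fintype.card_subtype]
    simp
  constructor
  · intro hi
    have hsub : Finset.Iic i ⊆ Finset.univ.filter fun i => lam i ≠ 0 := by
      intro j hj
      simp only [Finset.mem_filter, Finset.mem_univ, true_and]
      have h1 := hlam (Finset.mem_Iic.mp hj)
      have h2 := lt_of_le_of_ne (h0 i) (Ne.symm hi)
      linarith
    have := Finset.card_le_card hsub
    rw [hcard', Fin.card_Iic] at this
    omega
  · intro hi h
    have hsub : (Finset.univ.filter fun i => lam i ≠ 0) ⊆ Finset.Iio i := by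
      intro j hj
      simp only [Finset.mem_filter, Finset.mem_univ, true_and] at hj
      rw [Finset.mem_Iio]
      by_contra hij
      exact hj (le_antisymm (h ▸ hlam (not_lt.mp hij)) (h0 j))
    have := Finset.card_le_card hsub
    rw [hcard', Fin.card_Iio] at this
    omega

/-- The spectrum and the leading eigenvectors of `A C Aᴴ`. -/
lemma leading_eigenvectors_of_factorization {A : Matrix (Fin (K + n)) (Fin K) ℂ} (hA : Function.Injective A.mulVec)
    {C : Matrix (Fin K) (Fin K) ℂ} (hC : C.PosDef) (hK1 : K - 1 < K)
    {V : Matrix (Fin (K + n)) (Fin (K + n)) ℂ} (hV : V ∈ Matrix.unitaryGroup (Fin (K + n)) ℂ)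
    {lam : Fin (K + n) → ℝ} (hlam : Antitone lam)
    (hR : A * C * Aᴴ = V * Matrix.diagonal (fun j => (lam j : ℂ)) * Vᴴ) :
    (∀ j : Fin K, sv A K ^ 2 * eigDesc hC.isHermitian ⟨K - 1, hK1⟩ ≤ lam (Fin.castAdd n j)) ∧
    (∀ i : Fin n, lam (Fin.natAdd K i) = 0) ∧
    LinearMap.range (headCols V).mulVecLin = LinearMap.range A.mulVecLin := by
  set μ := eigDesc hC.isHermitian ⟨K - 1, hK1⟩ with hμ
  have hμ0 : 0 < μ := eigDesc_pos hC _
  have hV1 : Vᴴ * V = 1 := Matrix.mem_unitaryGroup_iff'.mp hV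
  have hV2 : V * Vᴴ = 1 := Matrix.mem_unitaryGroup_iff.mp hV
  set v : Fin (K + n) → EuclideanSpace ℂ (Fin (K + n)) := fun j =>
    Matrix.toEuclideanLin V (EuclideanSpace.single j 1) with hv
  have hv1 (j) : ‖v j‖ = 1 := by
    rw [hv, norm_toEuclideanLin_of_isometry hV1]; simp
  have hRv (j) : Matrix.toEuclideanLin (A * C * Aᴴ) (v j) = (lam j : ℂ) • v j := by
    rw [hv, ← toEuclideanLin_mul_apply, hR, Matrix.mul_assoc, hV1, Matrix.mul_one,
      toEuclideanLin_mul_apply, ← map_smul]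
    congr 1
    ext i
    simp only [Matrix.toLpLin_apply, Matrix.mulVec_diagonal, PiLp.smul_apply, smul_eq_mul]
    rcases eq_or_ne i j with rfl | h
    · simp
    · simp [h]
  have hquad (j) : μ * ‖Matrix.toEuclideanLin Aᴴ (v j)‖ ^ 2 ≤ lam j := by
    have h1 : (inner ℂ (v j) (Matrix.toEuclideanLin (A * C * Aᴴ) (v j))).re = lam j := by
      rw [hRv, inner_smul_right, inner_self_eq_norm_sq_to_K, hv1]
      simp
    rw [← h1, toEuclideanLin_mul_apply, toEuclideanLin_mul_apply, inner_toEuclideanLin_right]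
    exact eigDesc_last_mul_le hC.isHermitian hK1 _
  have hnn (j) : 0 ≤ lam j := (mul_nonneg hμ0.le (sq_nonneg _)).trans (hquad j)
  have hVdet : IsUnit V.det := (Matrix.isUnit_iff_isUnit_det V).mp
    (IsUnit.of_mul_eq_one Vᴴ hV2)
  have hVdet' : IsUnit Vᴴ.det := (Matrix.isUnit_iff_isUnit_det Vᴴ).mp
    (IsUnit.of_mul_eq_one V hV1)
  have hcard : Fintype.card {i // (lam i : ℂ) ≠ 0} = K := by
    rw [← Matrix.rank_diagonal, ← Matrix.rank_mul_eq_right_of_isUnit_det V _ hVdet,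
      ← Matrix.rank_mul_eq_left_of_isUnit_det Vᴴ _ hVdet', ← hR,
      rank_mul_posDef_mul_conjTranspose hA hC]
  have hne := ne_zero_iff_of_card hlam hnn hcard
  refine ⟨fun j => ?_, fun i => ?_, ?_⟩
  · have hj : lam (Fin.castAdd n j) ≠ 0 := (hne _).mpr (by simp)
    refine le_trans ?_ (hquad (Fin.castAdd n j))
    set w := v (Fin.castAdd n j) with hw
    -- An eigenvector with nonzero eigenvalue lies in the range of `A`. Then `1 = ⟨Aᴴ w, x⟩ ≤ ‖Aᴴ w‖
    -- * ‖x‖` and `sv A K * ‖x‖ ≤ 1` give `sv A K ≤ ‖Aᴴ w‖`.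
    obtain ⟨x, hx⟩ : ∃ x, Matrix.toEuclideanLin A x = w := by
      refine ⟨(lam (Fin.castAdd n j) : ℂ)⁻¹ • Matrix.toEuclideanLin (C * Aᴴ) w, ?_⟩
      rw [map_smul, ← toEuclideanLin_mul_apply, ← Matrix.mul_assoc, hRv, smul_smul,
        inv_mul_cancel₀ (by exact_mod_cast hj), one_smul]
    have h1 : sv A K * ‖x‖ ≤ 1 := by
      rw [← hv1 (Fin.castAdd n j), ← hw, ← hx]; exact sv_last_mul_le A x
    have h2 : 1 ≤ ‖Matrix.toEuclideanLin Aᴴ w‖ * ‖x‖ := by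
      have h3 := norm_inner_le_norm (𝕜 := ℂ) (Matrix.toEuclideanLin Aᴴ w) x
      rw [← inner_toEuclideanLin_right, hx, inner_self_eq_norm_sq_to_K, hv1] at h3
      simpa using h3
    have h0 : 0 ≤ sv A K := LinearMap.singularValues_nonneg _ _
    have h4 : sv A K ≤ ‖Matrix.toEuclideanLin Aᴴ w‖ := by
      nlinarith [mul_le_mul_of_nonneg_left h2 h0,
        mul_le_mul_of_nonneg_left h1 (norm_nonneg (Matrix.toEuclideanLin Aᴴ w))]
    rw [mul_comm]
    gcongr
  · by_contra h
    have := (hne _).mp h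
    simp at this
  · set H := headCols V with hH
    have hHH : Hᴴ * H = 1 := submatrix_isometry hV (Fin.castAdd_injective K n)
    have h1 : A * C * Aᴴ * H = H * Matrix.diagonal (fun j => (lam (Fin.castAdd n j) : ℂ)) :=
      mul_submatrix_of_diagonalization hV hR (Fin.castAdd n)
    have h2 : H = A * (C * Aᴴ * H
        * Matrix.diagonal fun j => (lam (Fin.castAdd n j) : ℂ)⁻¹) := by
      have h3 : Matrix.diagonal (fun j => (lam (Fin.castAdd n j) : ℂ))
          * Matrix.diagonal (fun j => (lam (Fin.castAdd n j) : ℂ)⁻¹) = 1 := by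
        rw [Matrix.diagonal_mul_diagonal, ← Matrix.diagonal_one]
        congr 1
        ext j
        have hj : lam (Fin.castAdd n j) ≠ 0 := (hne _).mpr (by simp)
        exact mul_inv_cancel₀ (by exact_mod_cast hj)
      rw [← Matrix.mul_assoc, ← Matrix.mul_assoc, ← Matrix.mul_assoc, h1, Matrix.mul_assoc, h3,
        Matrix.mul_one]
    refine Submodule.eq_of_le_of_finrank_eq ?_ ?_
    · rw [h2, Matrix.mulVecLin_mul]
      exact LinearMap.range_comp_le_range _ _
    · change H.rank = A.rank
      rw [rank_eq_of_injective hA, ← Matrix.rank_conjTranspose_mul_self, hHH, Matrix.rank_one,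
        Fintype.card_fin]

end Signal

/-! ### Vandermonde structure of the array. -/

section Array

variable {K L M N P : ℕ} (f : Fin K → ℝ)

lemma norm_node (k : Fin K) : ‖node f k‖ = 1 := by
  rw [node, show (2 * Real.pi * Complex.I * f k : ℂ) = ((2 * Real.pi * f k : ℝ) : ℂ) * Complex.I by
    push_cast; ring]
  exact Complex.norm_exp_ofReal_mul_I _

lemma node_ne_zero (k : Fin K) : node f k ≠ 0 := Complex.exp_ne_zero _

lemma conj_node (k : Fin K) : starRingEnd ℂ (node f k) = (node f k)⁻¹ :=
  (Complex.inv_eq_conj (norm_node f k)).symm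

variable {f} in
lemma node_injective (hf : Function.Injective f) (hf01 : ∀ k, f k ∈ Set.Ico (0 : ℝ) 1) :
    Function.Injective (node f) := by
  intro k l h
  obtain ⟨z, hz⟩ := Complex.exp_eq_exp_iff_exists_int.mp h
  have h1 : (2 * Real.pi * Complex.I) * (f k : ℂ) = (2 * Real.pi * Complex.I) * (f l + z : ℂ) := by
    rw [hz]; ring
  have h2 : f k = f l + z := by
    have := mul_left_cancel₀ Complex.two_pi_I_ne_zero h1
    exact_mod_cast this
  obtain ⟨hk0, hk1⟩ := hf01 k
  obtain ⟨hl0, hl1⟩ := hf01 l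
  have hz1 : (z : ℝ) < 1 := by linarith
  have hz2 : (-1 : ℝ) < z := by linarith
  have hz0 : z = 0 := by
    have : z < 1 := by exact_mod_cast hz1
    have : -1 < z := by exact_mod_cast hz2
    omega
  exact hf (by rw [h2, hz0]; simp)

variable {f} in
-- The top `K × K` block is a transposed Vandermonde matrix with distinct nodes.
lemma vander_mulVec_injective (hKM : K ≤ M) (hf : Function.Injective f)
    (hf01 : ∀ k, f k ∈ Set.Ico (0 : ℝ) 1) : Function.Injective (vander M f).mulVec := by
  have key : ∀ x, (vander M f).mulVec x = 0 → x = 0 := by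
    intro x hx
    refine Matrix.eq_zero_of_mulVec_eq_zero (M := (Matrix.vandermonde (node f))ᵀ) ?_ ?_
    · rw [Matrix.det_transpose, Matrix.det_vandermonde_ne_zero_iff]
      exact node_injective hf hf01
    · ext i
      have := congrFun hx (Fin.castLE hKM i)
      simpa [Matrix.mulVec, dotProduct, vander, Matrix.vandermonde_apply] using this
  intro x y hxy
  exact sub_eq_zero.mp (key _ (by rw [Matrix.mulVec_sub, sub_eq_zero]; exact hxy))

lemma Zpow_conjTranspose (a : ℤ) : (Zpow f a)ᴴ = Zpow f (-a) := by
  rw [Zpow, Matrix.diagonal_conjTranspose, Zpow]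
  congr 1
  ext k
  change starRingEnd ℂ (node f k ^ a) = _
  rw [map_zpow₀, conj_node, inv_zpow, zpow_neg]

lemma norm_Zpow_le (a : ℤ) : ‖Zpow f a‖ ≤ 1 := by
  rw [Zpow, Matrix.l2_opNorm_diagonal, pi_norm_le_iff_of_nonneg zero_le_one]
  intro k
  rw [norm_zpow, norm_node, one_zpow]

lemma subarray_add (hN : M + P = N + 1) (X Y : Matrix (Fin N) (Fin L) ℂ) (p : Fin P) :
    subarray hN (X + Y) p = subarray hN X p + subarray hN Y p := rfl

lemma subarray_vander_mul (hN : M + P = N + 1) (S : Matrix (Fin K) (Fin L) ℂ) (p : Fin P) :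
    subarray hN (vander N f * S) p = vander M f * Zpow f (p : ℤ) * S := by
  ext i l
  change ∑ k, node f k ^ ((p : ℕ) + (i : ℕ)) * S k l
    = ∑ k, (vander M f * Zpow f (p : ℤ)) i k * S k l
  refine Finset.sum_congr rfl fun k _ => ?_
  rw [Zpow, Matrix.mul_diagonal, zpow_natCast, vander, Matrix.of_apply, ← pow_add, add_comm]

lemma dataCovSS_vander_mul (hN : M + P = N + 1) (S : Matrix (Fin K) (Fin L) ℂ) :
    dataCovSS hN (vander N f * S)
      = vander M f * smoothedSource P f (sourceCov S) * (vander M f)ᴴ := by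
  rw [dataCovSS, smoothedSource, Matrix.mul_smul, Matrix.smul_mul, Matrix.mul_sum, Matrix.sum_mul,
    show (1 / (L * P) : ℂ) = (1 / P) * (1 / L) by rw [one_div_mul_one_div, mul_comm], mul_smul,
    Finset.smul_sum]
  congr 1
  refine Finset.sum_congr rfl fun p _ => ?_
  rw [subarray_vander_mul, sourceCov, Matrix.conjTranspose_mul, Matrix.conjTranspose_mul,
    Zpow_conjTranspose]
  simp only [Matrix.mul_smul, Matrix.smul_mul, Matrix.mul_assoc]

lemma conj_mul {m n p : ℕ} (A : Matrix (Fin m) (Fin n) ℂ) (B : Matrix (Fin n) (Fin p) ℂ) :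
    conj (A * B) = conj A * conj B :=
  Matrix.map_mul

lemma conj_conjTranspose {m n : ℕ} (A : Matrix (Fin m) (Fin n) ℂ) : conj Aᴴ = (conj A)ᴴ := rfl

lemma reversal_mul {m : ℕ} (A : Matrix (Fin M) (Fin m) ℂ) :
    reversal M * A = A.submatrix Fin.rev id := by
  ext i j
  simp [reversal, Matrix.mul_apply]

lemma reversal_conjTranspose : (reversal M)ᴴ = reversal M := by
  ext i j
  simp only [reversal, Matrix.conjTranspose_apply, Matrix.of_apply]
  have : i = Fin.rev j ↔ j = Fin.rev i := by
    constructor <;> rintro rfl <;> simp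
  by_cases h : i = Fin.rev j
  · rw [if_pos h, if_pos (this.mp h), star_one]
  · rw [if_neg h, if_neg (fun h' => h (this.mpr h')), star_zero]

lemma reversal_mul_self : reversal M * reversal M = 1 := by
  rw [reversal_mul]
  ext i j
  simp [reversal, Matrix.one_apply, eq_comm]

/-- On the unit circle conjugation inverts the nodes, and `z^{-(M-1-i)} = z^i z^{1-M}`. This is what
makes backward smoothing compatible with the signal subspace. -/
lemma reversal_mul_conj_vander : reversal M * conj (vander M f)
    = vander M f * Zpow f (1 - (M : ℤ)) := by
  rw [reversal_mul]
  ext i k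
  simp only [Matrix.submatrix_apply, id, conj, Matrix.map_apply, vander, Matrix.of_apply, Zpow,
    Matrix.mul_diagonal, map_pow, conj_node]
  rw [inv_pow, ← zpow_natCast, ← zpow_natCast, ← zpow_neg, ← zpow_add₀ (node_ne_zero f k)]
  congr 1
  have := i.isLt
  rw [Fin.val_rev]
  omega

lemma dataCovFB_vander_mul (hN : M + P = N + 1) (S : Matrix (Fin K) (Fin L) ℂ) :
    dataCovFB hN (vander N f * S)
      = vander M f * smoothedSourceFB M P f (sourceCov S) * (vander M f)ᴴ := by
  rw [dataCovFB, dataCovSS_vander_mul, smoothedSourceFB, Matrix.mul_smul, Matrix.smul_mul,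
    Matrix.mul_add, Matrix.add_mul]
  congr 2
  have h : (conj (vander M f))ᴴ * reversal M = Zpow f ((M : ℤ) - 1) * (vander M f)ᴴ := by
    have := congrArg Matrix.conjTranspose (reversal_mul_conj_vander (M := M) f)
    rw [Matrix.conjTranspose_mul, Matrix.conjTranspose_mul, reversal_conjTranspose,
      Zpow_conjTranspose] at this
    rw [this]
    congr 2
    ring
  rw [conj_mul, conj_mul, conj_conjTranspose]
  calc _ = (reversal M * conj (vander M f)) * conj (smoothedSource P f (sourceCov S))
        * ((conj (vander M f))ᴴ * reversal M) := by simp only [Matrix.mul_assoc]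
    _ = _ := by rw [reversal_mul_conj_vander, h]; simp only [Matrix.mul_assoc]

end Array

/-! ### Deterministic bounds for the covariance error. -/

section Perturbation

variable {K L M N P : ℕ}

lemma norm_conj_le {m n : ℕ} (A : Matrix (Fin m) (Fin n) ℂ) : ‖conj A‖ ≤ ‖A‖ := by
  refine norm_le_of_forall_toEuclideanLin (norm_nonneg _) fun x => ?_
  set y : EuclideanSpace ℂ (Fin n) := WithLp.toLp 2 fun i => starRingEnd ℂ (x i) with hy
  have h1 : ‖y‖ = ‖x‖ := by
    simp [hy, EuclideanSpace.norm_eq]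
  have h2 : ‖Matrix.toEuclideanLin (conj A) x‖ = ‖Matrix.toEuclideanLin A y‖ := by
    rw [EuclideanSpace.norm_eq, EuclideanSpace.norm_eq]
    congr 1
    refine Finset.sum_congr rfl fun i _ => ?_
    rw [← RCLike.norm_conj]
    simp [Matrix.toLpLin_apply, Matrix.mulVec, dotProduct, conj, hy]
  rw [h2, ← h1]
  exact norm_toEuclideanLin_apply_le A y

lemma norm_reversal_le : ‖reversal M‖ ≤ 1 :=
  norm_le_one_of_isometry (by rw [reversal_conjTranspose, reversal_mul_self])

/-- Backward averaging fixes real multiples of the identity, and `D ↦ J conj(D) J` does not increase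
the norm. -/
lemma norm_dataCovFB_sub_le (hN : M + P = N + 1) (X Y : Matrix (Fin N) (Fin L) ℂ) (s : ℝ) :
    ‖dataCovFB hN X - dataCovFB hN Y - (s : ℂ) • 1‖
      ≤ ‖dataCovSS hN X - dataCovSS hN Y - (s : ℂ) • 1‖ := by
  set D := dataCovSS hN X - dataCovSS hN Y - (s : ℂ) • 1 with hD
  have hconj : conj D = conj (dataCovSS hN X) - conj (dataCovSS hN Y) - (s : ℂ) • 1 := by
    rw [hD]
    ext i j
    rcases eq_or_ne i j with rfl | h
    · simp [conj]
    · simp [conj, h]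
  have h : dataCovFB hN X - dataCovFB hN Y - (s : ℂ) • 1
      = (1 / 2 : ℂ) • (D + reversal M * conj D * reversal M) := by
    rw [hconj, Matrix.mul_sub, Matrix.mul_sub, Matrix.sub_mul, Matrix.sub_mul, Matrix.mul_smul,
      Matrix.smul_mul, Matrix.mul_one, reversal_mul_self, hD, dataCovFB, dataCovFB]
    module
  rw [h, norm_smul]
  have h1 : ‖reversal M * conj D * reversal M‖ ≤ ‖D‖ := by
    calc _ ≤ ‖reversal M‖ * ‖conj D‖ * ‖reversal M‖ :=
          (Matrix.l2_opNorm_mul _ _).trans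
            (mul_le_mul_of_nonneg_right (Matrix.l2_opNorm_mul _ _) (norm_nonneg _))
      _ ≤ 1 * ‖D‖ * 1 := by
          gcongr
          · exact norm_reversal_le
          · exact norm_conj_le D
          · exact norm_reversal_le
      _ = ‖D‖ := by ring
  have h2 := norm_add_le D (reversal M * conj D * reversal M)
  norm_num
  linarith

/-- Expanding the square leaves a cross term, its adjoint of equal norm, and the centred noise
covariance. Averaging over `p` preserves a uniform bound, even though the subarrays overlap. -/
lemma norm_dataCovSS_sub_le (hP : 0 < P) (hL : 0 < L) (hN : M + P = N + 1)
    (X E : Matrix (Fin N) (Fin L) ℂ) {s a b : ℝ}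
    (ha : ∀ p, ‖subarray hN X p * (subarray hN E p)ᴴ‖ ≤ a)
    (hb : ∀ p, ‖subarray hN E p * (subarray hN E p)ᴴ - ((s * L : ℝ) : ℂ) • 1‖ ≤ b) :
    ‖dataCovSS hN (X + E) - dataCovSS hN X - (s : ℂ) • 1‖ ≤ (2 * a + b) / L := by
  have hP' : (P : ℂ) ≠ 0 := by exact_mod_cast hP.ne'
  have hL' : (L : ℂ) ≠ 0 := by exact_mod_cast hL.ne'
  have hP'' : (0 : ℝ) < P := by exact_mod_cast hP
  have hL'' : (0 : ℝ) < L := by exact_mod_cast hL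
  have h : dataCovSS hN (X + E) - dataCovSS hN X - (s : ℂ) • 1
      = (1 / (L * P) : ℂ) • ∑ p : Fin P, (subarray hN X p * (subarray hN E p)ᴴ
        + (subarray hN X p * (subarray hN E p)ᴴ)ᴴ
        + (subarray hN E p * (subarray hN E p)ᴴ - ((s * L : ℝ) : ℂ) • 1)) := by
    have h1 : (s : ℂ) • (1 : Matrix (Fin M) (Fin M) ℂ)
        = (1 / (L * P) : ℂ) • ∑ _p : Fin P, ((s * L : ℝ) : ℂ) • 1 := by
      rw [Finset.sum_const, Finset.card_univ, Fintype.card_fin, ← Nat.cast_smul_eq_nsmul ℂ,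
        smul_smul, smul_smul]
      congr 1
      push_cast
      field_simp
    rw [h1, dataCovSS, dataCovSS, ← smul_sub, ← smul_sub, ← Finset.sum_sub_distrib,
      ← Finset.sum_sub_distrib]
    congr 1
    refine Finset.sum_congr rfl fun p _ => ?_
    rw [subarray_add, Matrix.conjTranspose_add, Matrix.conjTranspose_mul,
      Matrix.conjTranspose_conjTranspose, Matrix.add_mul, Matrix.mul_add, Matrix.mul_add]
    abel
  have hsum : ‖∑ p : Fin P, (subarray hN X p * (subarray hN E p)ᴴ
        + (subarray hN X p * (subarray hN E p)ᴴ)ᴴ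
        + (subarray hN E p * (subarray hN E p)ᴴ - ((s * L : ℝ) : ℂ) • 1))‖
      ≤ P * (2 * a + b) := by
    refine (norm_sum_le_of_le Finset.univ (n := fun _ => 2 * a + b) fun p _ => ?_).trans
      (le_of_eq (by rw [Finset.sum_const, Finset.card_univ, Fintype.card_fin, nsmul_eq_mul]))
    refine (norm_add₃_le).trans ?_
    rw [Matrix.l2_opNorm_conjTranspose]
    linarith [ha p, hb p]
  rw [h, norm_smul]
  have hc : ‖(1 / (L * P) : ℂ)‖ = 1 / (L * P) := by
    simp
  rw [hc]
  calc 1 / ((L : ℝ) * P) * _ ≤ 1 / ((L : ℝ) * P) * (P * (2 * a + b)) := by gcongr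
    _ = _ := by field_simp

lemma norm_sq_eq_sourceCov (hL : 0 < L) (S : Matrix (Fin K) (Fin L) ℂ) :
    ‖S‖ = √L * √‖sourceCov S‖ := by
  have hL' : (0 : ℝ) < L := by exact_mod_cast hL
  have h1 := Matrix.l2_opNorm_conjTranspose_mul_self Sᴴ
  rw [Matrix.conjTranspose_conjTranspose, Matrix.l2_opNorm_conjTranspose] at h1
  rw [sourceCov, norm_smul, h1, ← Real.sqrt_mul hL'.le]
  have : (L : ℝ) * (‖(1 / L : ℂ)‖ * (‖S‖ * ‖S‖)) = ‖S‖ ^ 2 := by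
    simp
    field_simp
  rw [this, Real.sqrt_sq (norm_nonneg _)]

variable {Ω : Type*} [MeasurableSpace Ω] {μ : Measure Ω} {σ : ℝ}

lemma IsGaussianNoise.of_subarray (hN : M + P = N + 1) {E : Ω → Matrix (Fin N) (Fin L) ℂ}
    (hE : IsGaussianNoise μ E σ) (p : Fin P) :
    IsGaussianNoise μ (fun ω => subarray hN (E ω) p) σ where
  indep := by
    have hinj : Function.Injective fun q : Fin M × Fin L =>
        ((⟨(p : ℕ) + (q.1 : ℕ), by omega⟩, q.2) : Fin N × Fin L) := by
      rintro ⟨i, l⟩ ⟨i', l'⟩ h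
      simp only [Prod.mk.injEq, Fin.mk.injEq] at h
      exact Prod.ext (Fin.ext (by simpa using h.1)) h.2
    exact hE.indep.precomp hinj
  law i l := hE.law _ l

end Perturbation

/-! ### The good event and its consequences. -/

section Main

variable {K L M N P : ℕ}

/-- The event that the noise is small in every subarray. -/
def smallNoise (hN : M + P = N + 1) (σ : ℝ) (S : Matrix (Fin K) (Fin L) ℂ) :
    Set (Matrix (Fin N) (Fin L) ℂ) :=
  {E | ∀ p, ‖S * (subarray hN E p)ᴴ‖ ≤ 3 * √M * σ * ‖S‖ ∧
    ‖subarray hN E p * (subarray hN E p)ᴴ - ((σ ^ 2 * L : ℝ) : ℂ) • 1‖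
      ≤ σ ^ 2 * (8 * max (√(M * L)) M)}

/-- Overlapping subarrays are dependent, but each one is white noise by itself, so a union bound
over `p` suffices. -/
lemma IsGaussianNoise.measure_compl_smallNoise_le {Ω : Type*} [MeasurableSpace Ω] {μ : Measure Ω}
    {σ : ℝ} (hσ : 0 ≤ σ) (hM : 0 < M) (hL : 0 < L) (hKM : K ≤ M) (hN : M + P = N + 1)
    {E : Ω → Matrix (Fin N) (Fin L) ℂ} (hE : IsGaussianNoise μ E σ)
    (S : Matrix (Fin K) (Fin L) ℂ) :
    μ {ω | E ω ∉ smallNoise hN σ S}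
      ≤ ENNReal.ofReal (3 * (P : ℝ) * Real.exp (-(M : ℝ) / 2)) := by
  have hsub : {ω | E ω ∉ smallNoise hN σ S} ⊆ ⋃ p : Fin P,
      ({ω | 3 * √M * σ * ‖S‖ < ‖S * (subarray hN (E ω) p)ᴴ‖} ∪
        {ω | σ ^ 2 * (8 * max (√(M * L)) M)
          < ‖subarray hN (E ω) p * (subarray hN (E ω) p)ᴴ - ((σ ^ 2 * L : ℝ) : ℂ) • 1‖}) := by
    intro ω hω
    have h : ¬ ∀ p, _ := hω
    push Not at h
    obtain ⟨p, hp⟩ := h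
    rw [Set.mem_iUnion]
    refine ⟨p, ?_⟩
    by_cases h1 : ‖S * (subarray hN (E ω) p)ᴴ‖ ≤ 3 * √M * σ * ‖S‖
    · exact Or.inr (hp h1)
    · exact Or.inl (not_le.mp h1)
  have he := (Real.exp_pos (-(M : ℝ) / 2)).le
  refine (measure_mono hsub).trans ((measure_iUnion_fintype_le _ _).trans ?_)
  calc _ ≤ ∑ _p : Fin P, ENNReal.ofReal (3 * Real.exp (-(M : ℝ) / 2)) := by
        refine Finset.sum_le_sum fun p _ => (measure_union_le _ _).trans ?_
        rw [show 3 * Real.exp (-(M : ℝ) / 2)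
          = Real.exp (-(M : ℝ) / 2) + 2 * Real.exp (-(M : ℝ) / 2) by ring,
          ENNReal.ofReal_add he (by positivity)]
        exact add_le_add ((hE.of_subarray hN p).norm_mul hM hKM hσ S)
          ((hE.of_subarray hN p).wishart hM hL)
    _ = _ := by
        rw [Finset.sum_const, Finset.card_univ, Fintype.card_fin, nsmul_eq_mul,
          ← ENNReal.ofReal_natCast, ← ENNReal.ofReal_mul (Nat.cast_nonneg P)]
        ring_nf

/-- The size of the perturbation of the smoothed covariance when the noise is small. -/
lemma norm_perturbation_le (hP : 0 < P) (hL : 0 < L) (hN : M + P = N + 1) (f : Fin K → ℝ)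
    {σ : ℝ} {S : Matrix (Fin K) (Fin L) ℂ} {E : Matrix (Fin N) (Fin L) ℂ}
    (hE : E ∈ smallNoise hN σ S) :
    2 * ‖dataCovFB hN (vander N f * S + E) - dataCovFB hN (vander N f * S) - ((σ ^ 2 : ℝ) : ℂ) • 1‖
      ≤ 12 * σ * ‖vander M f‖ * √‖sourceCov S‖ * √((M : ℝ) / L)
        + 16 * σ ^ 2 * max (√((M : ℝ) / L)) ((M : ℝ) / L) := by
  have hL' : (0 : ℝ) < L := by exact_mod_cast hL
  have h1 := (norm_dataCovFB_sub_le hN (vander N f * S + E) (vander N f * S) (σ ^ 2)).trans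
    (norm_dataCovSS_sub_le hP hL hN (vander N f * S) E
      (a := ‖vander M f‖ * (3 * √M * σ * ‖S‖)) (fun p => ?_) (fun p => (hE p).2))
  -- With `‖S‖ = √L * √‖sourceCov S‖`, the constants are `12 = 2 * 2 * 3` and `16 = 2 * 8`.
  · refine (mul_le_mul_of_nonneg_left h1 zero_le_two).trans (le_of_eq ?_)
    have h2 : √((M : ℝ) / L) = √M / √L := Real.sqrt_div (Nat.cast_nonneg M) _
    have h3 : √(L : ℝ) * √L = L := Real.mul_self_sqrt hL'.le
    have h4 : max (√(M * L)) (M : ℝ) / L = max (√((M : ℝ) / L)) ((M : ℝ) / L) := by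
      rw [← max_div_div_right hL'.le, h2, Real.sqrt_mul (Nat.cast_nonneg M)]
      congr 1
      rw [div_eq_div_iff hL'.ne' (by positivity), mul_assoc, h3]
    rw [← h4, h2, norm_sq_eq_sourceCov hL S]
    have h5 : (√(L : ℝ)) ≠ 0 := by positivity
    rw [add_div, mul_add]
    congr 1
    · have h6 : √(L : ℝ) / L = 1 / √L := by
        rw [div_eq_div_iff hL'.ne' h5, h3, one_mul]
      linear_combination 12 * σ * ‖vander M f‖ * √‖sourceCov S‖ * √(M : ℝ) * h6
    · field_simp
      ring
  · rw [subarray_vander_mul, Matrix.mul_assoc, Matrix.mul_assoc]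
    calc _ ≤ ‖vander M f‖ * (‖Zpow f (p : ℤ)‖ * ‖S * (subarray hN E p)ᴴ‖) :=
          (Matrix.l2_opNorm_mul _ _).trans
            (mul_le_mul_of_nonneg_left (Matrix.l2_opNorm_mul _ _) (norm_nonneg _))
      _ ≤ ‖vander M f‖ * (1 * ‖S * (subarray hN E p)ᴴ‖) := by
          gcongr
          exact norm_Zpow_le f _
      _ ≤ _ := by
          rw [one_mul]
          gcongr
          exact (hE p).1

end Main

end FBSS

end

/-! ### Assembly of the theorem. -/

theorem theorem11 {Ω : Type*} [MeasurableSpace Ω] (μ : Measure Ω) [IsProbabilityMeasure μ]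
    (N M P K L : ℕ) (hK : 1 ≤ K) (hKM : K ≤ M) (hP : 1 ≤ P) (hN : M + P = N + 1) (hL : 1 ≤ L)
    (σ : ℝ) (hσ : 0 ≤ σ)
    (f : Fin K → ℝ) (hf : Function.Injective f) (hf01 : ∀ k, f k ∈ Set.Ico (0 : ℝ) 1)
    (S : Matrix (Fin K) (Fin L) ℂ)
    (E : Ω → Matrix (Fin N) (Fin L) ℂ) (hE : FBSS.IsGaussianNoise μ E σ)
    (hpos : (FBSS.smoothedSourceFB M P f (FBSS.sourceCov S)).PosDef)
    (hbound : FBSS.errorBound M f S σ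
      (FBSS.eigDesc hpos.isHermitian ⟨K - 1, by omega⟩) < 0.586) :
    (∀ U : Matrix (Fin M) (Fin K) ℂ,
      FBSS.IsLeadingEigenvectors hKM (FBSS.dataCovFB hN (FBSS.vander N f * S)) U →
        LinearMap.range U.mulVecLin = LinearMap.range (FBSS.vander M f).mulVecLin) ∧
    ∃ G : Set Ω, MeasurableSet G ∧ 1 - 3 * (P : ℝ) * Real.exp (-(M : ℝ) / 2) ≤ μ.real G ∧
      ∀ ω ∈ G, ∀ U Uhat : Matrix (Fin M) (Fin K) ℂ,
        FBSS.IsLeadingEigenvectors hKM (FBSS.dataCovFB hN (FBSS.vander N f * S)) U →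
        FBSS.IsLeadingEigenvectors hKM (FBSS.dataCovFB hN (FBSS.vander N f * S + E ω)) Uhat →
          FBSS.subspaceDist Uhat U ≤ FBSS.errorBound M f S σ
            (FBSS.eigDesc hpos.isHermitian ⟨K - 1, by omega⟩) := by
  open FBSS in
  obtain ⟨n, rfl⟩ := Nat.exists_eq_add_of_le hKM
  have hA := vander_mulVec_injective hKM hf hf01
  have hR := dataCovFB_vander_mul f hN S
  refine ⟨?_, ?_⟩
  · rintro U ⟨V, hV, lam, hlam, hVR, hU⟩
    obtain rfl : U = headCols V := by ext i j; exact hU i j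
    exact (leading_eigenvectors_of_factorization hA hpos (by omega) hV hlam
      (hR.symm.trans hVR)).2.2
  set lamK := eigDesc hpos.isHermitian ⟨K - 1, by omega⟩ with hlamK
  set B := errorBound (K + n) f S σ lamK with hB
  set bad : Set Ω := {ω | E ω ∉ smallNoise hN σ S} with hbad
  -- `E` is only almost everywhere measurable, so the bad event is replaced by a measurable hull of
  -- the same measure.
  refine ⟨(toMeasurable μ bad)ᶜ, (measurableSet_toMeasurable μ bad).compl, ?_, ?_⟩
  · rw [probReal_compl_eq_one_sub (measurableSet_toMeasurable μ bad)]
    have h1 : μ.real (toMeasurable μ bad) ≤ 3 * (P : ℝ) * Real.exp (-((K + n : ℕ) : ℝ) / 2) := by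
      rw [Measure.real, measure_toMeasurable]
      exact ENNReal.toReal_le_of_le_ofReal (by positivity)
        (hE.measure_compl_smallNoise_le hσ (by omega) hL hKM hN S)
    linarith
  · rintro ω hω U Uhat ⟨V, hV, lam, hlam, hVR, hU⟩ ⟨V', hV', lam', hlam', hVR', hU'⟩
    obtain rfl : U = headCols V := by ext i j; exact hU i j
    obtain rfl : Uhat = headCols V' := by ext i j; exact hU' i j
    have hgood : E ω ∈ smallNoise hN σ S := by
      by_contra h
      exact hω (subset_toMeasurable μ bad h)
    obtain ⟨hlead, htail, -⟩ := leading_eigenvectors_of_factorization hA hpos (by omega) hV hlam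
      (hR.symm.trans hVR)
    have hsv : 0 < sv (vander (K + n) f) K := sv_last_pos hK fun x y hxy => by
      have := congrArg (WithLp.ofLp) hxy
      simp only [Matrix.toLpLin_apply] at this
      exact WithLp.ofLp_injective 2 (hA this)
    have hg : 0 < sv (vander (K + n) f) K ^ 2 * lamK := mul_pos (pow_pos hsv 2) (eigDesc_pos hpos _)
    set g := sv (vander (K + n) f) K ^ 2 * lamK with hgdef
    set Δ := dataCovFB hN (vander N f * S + E ω) - dataCovFB hN (vander N f * S)
      - ((σ ^ 2 : ℝ) : ℂ) • 1 with hΔ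
    have hΔB : 2 * ‖Δ‖ ≤ B * g := by
      rw [hB, errorBound, div_mul_cancel₀ _ hg.ne']
      exact norm_perturbation_le hP hL hN f hgood
    have hB1 : B < 1 := hbound.trans (by norm_num)
    have hηg : ‖Δ‖ ≤ g / 2 := by nlinarith
    have hdk := norm_tail_mul_head_le hK hV hV' hlam' hVR hVR' (s := σ ^ 2) (g := g) (Δ := Δ)
      (by rw [hΔ]; abel) le_rfl (by linarith) hlead htail
    -- As `‖Δ‖ ≤ g / 2`, the denominator is at least `g / 2` and the quotient at most `2 * ‖Δ‖ / g ≤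
    -- B`.
    have hle : ‖Δ‖ / (g - ‖Δ‖) ≤ B := by
      rw [div_le_iff₀ (by linarith)]
      have hB0 : 0 ≤ B := by
        by_contra h
        have := mul_neg_of_neg_of_pos (not_le.mp h) hg
        linarith [norm_nonneg Δ]
      nlinarith
    exact subspaceDist_head_le hV hV' (hdk.trans hle) hB1
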